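/- **Theorem 3.2.** Let $n\ge 1$, let $\gamma_n(E)=(\sqrt{2\pi})^{-n}\int_E e^{-|x|^2/2}\,dx$ be the Gaussian probability measure on $\mathbb R^n$, and let $K\subset\mathbb R^n$ be a convex body (compact and convex) with the origin in its interior. Write $h_K(y)=\max\{x\cdot y: x\in K\}$ for its support function, $[g]=\{x\in\mathbb R^n: x\cdot v\le g(v)\text{ for all }v\in S^{n-1}\}$ for the Wulff shape of a function $g$ on $S^{n-1}$, and, for $\eta\subset S^{n-1}$, $\nu_K^{-1}(\eta)=\{x\in\partial K: x\cdot v=h_K(v)\text{ for some }v\in\eta\}$. Then $$S_{\gamma_n,K}(\eta)=\frac1{(\sqrt{2\pi})^n}\int_{\nu_K^{-1}(\eta)}e^{-|x|^2/2}\,d\mathcal H^{n-1}(x),\qquad \eta\subset S^{n-1}\text{ Borel},$$ is a finite Borel measure on $S^{n-1}$ (the Gaussian surface area measure of $K$), and for every $f\in C(S^{n-1})$ $$\lim_{t\to0}\frac{\gamma_n([h_K+tf])-\gamma_n(K)}{t}=\int_{S^{n-1}}f\,dS_{\gamma_n,K}.$$ Moreover, $S_{\gamma_n,K}$ is the only finite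 Borel measure on $S^{n-1}$ for which this formula holds for every $f\in C(S^{n-1})$. -/

import Mathlib

open MeasureTheory Filter Topology
open scoped RealInnerProductSpace ENNReal

noncomputable section

/-- The unit sphere of `n`-dimensional Euclidean space. -/
abbrev UnitSphere (n : ℕ) : Type := Metric.sphere (0 : EuclideanSpace ℝ (Fin n)) 1

/-- The Gaussian probability measure: `γ_n(E) = (√(2π))⁻ⁿ ∫_E exp(-|x|²/2) dx`. -/
def gaussianMeasure (n : ℕ) : Measure (EuclideanSpace ℝ (Fin n)) :=
  volume.withDensity fun x =>
    ENNReal.ofReal (1 / (√(2 * Real.pi)) ^ n * Real.exp (-‖x‖ ^ 2 / 2))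

/-- The support function `h_K(y) = max {x · y : x ∈ K}`; the supremum is a maximum because a
`ConvexBody` is compact and nonempty. -/
def supportFunction {n : ℕ} (K : ConvexBody (EuclideanSpace ℝ (Fin n)))
    (y : EuclideanSpace ℝ (Fin n)) : ℝ :=
  sSup ((fun x => ⟪x, y⟫) '' (K : Set (EuclideanSpace ℝ (Fin n))))

/-- The Wulff shape `[f] = {x : x · v ≤ f(v) for all unit vectors v}`. -/
def wulffShape {n : ℕ} (f : UnitSphere n → ℝ) : Set (EuclideanSpace ℝ (Fin n)) :=
  {x | ∀ v : UnitSphere n, ⟪x, (v : EuclideanSpace ℝ (Fin n))⟫ ≤ f v}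

/-- The unit vector `v` is an outer unit normal of `K` at `x`, i.e. `x ∈ K` lies on the supporting
hyperplane of `K` with outer normal `v`. -/
def IsOuterUnitNormal {n : ℕ} (K : ConvexBody (EuclideanSpace ℝ (Fin n)))
    (x : EuclideanSpace ℝ (Fin n)) (v : UnitSphere n) : Prop :=
  x ∈ K ∧ ⟪x, (v : EuclideanSpace ℝ (Fin n))⟫ = supportFunction K v

/-- The inverse Gauss map `ν_K⁻¹(η)`: the boundary points of `K` at which some `v ∈ η` is an
outer unit normal. -/
def inverseGaussImage {n : ℕ} (K : ConvexBody (EuclideanSpace ℝ (Fin n)))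
    (η : Set (UnitSphere n)) : Set (EuclideanSpace ℝ (Fin n)) :=
  {x | x ∈ frontier (K : Set (EuclideanSpace ℝ (Fin n))) ∧ ∃ v ∈ η, IsOuterUnitNormal K x v}

/-- The set function `η ↦ (√(2π))⁻ⁿ ∫_{ν_K⁻¹(η)} exp(-|x|²/2) dℋⁿ⁻¹(x)`, with values in `[0, ∞]`.
Here `μHE[d]` is Mathlib's `d`-dimensional Hausdorff measure, normalized so that it
agrees with Lebesgue measure on `d`-dimensional Euclidean space. -/
def gaussianSurfaceArea {n : ℕ} (K : ConvexBody (EuclideanSpace ℝ (Fin n)))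
    (η : Set (UnitSphere n)) : ℝ≥0∞ :=
  ENNReal.ofReal (1 / (√(2 * Real.pi)) ^ n) *
    ∫⁻ x in inverseGaussImage K η, ENNReal.ofReal (Real.exp (-‖x‖ ^ 2 / 2)) ∂μHE[n - 1]

/-- The Borel measure `S` on the sphere is the Gaussian surface area measure of `K`: its value at
each Borel set `η` is `(√(2π))⁻ⁿ ∫_{ν_K⁻¹(η)} exp(-|x|²/2) dℋⁿ⁻¹(x)`. This determines `S`. -/
def IsGaussianSurfaceAreaMeasure {n : ℕ} (K : ConvexBody (EuclideanSpace ℝ (Fin n)))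
    (S : Measure (UnitSphere n)) : Prop :=
  ∀ η : Set (UnitSphere n), MeasurableSet η → S η = gaussianSurfaceArea K η

/-- The first variation of `γ_n` at `K` is represented by the measure `μ`: for every continuous `f`
on the sphere, `lim_{t → 0} (γ_n([h_K + t f]) - γ_n(K)) / t = ∫ f dμ`. -/
def HasGaussianFirstVariation {n : ℕ} (K : ConvexBody (EuclideanSpace ℝ (Fin n)))
    (μ : Measure (UnitSphere n)) : Prop :=
  ∀ f : C(UnitSphere n, ℝ),
    Tendsto
      (fun t : ℝ =>
        ((gaussianMeasure n).real (wulffShape fun v => supportFunction K v + t * f v) -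
          (gaussianMeasure n).real (K : Set (EuclideanSpace ℝ (Fin n)))) / t)
      (𝓝[≠] 0) (𝓝 (∫ v, f v ∂μ))

end

/-! Write `ρ_L(u) = (gauge L u)⁻¹` for the radial function of a convex body `L` around the origin.
In polar coordinates the Gaussian measure of `L` is, up to a constant, the integral over the sphere
of `radialMass n (ρ_L(u))`, so its variation reduces to that of the radial function.

For `L_t = [h_K + t f]`, `ρ_{L_t}(u)` is the largest `s` with `s (u · v) ≤ h_K(v) + t f(v)` for all
`v`. If the boundary point `ρ_K(u) u` has a single normal `w`, only the constraint at `w` is tight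
at `t = 0`, and the derivative there is `f(w) / (u · w)` (`hasDerivAt_inv_gauge_wulffShape`). The
gauge is Lipschitz, hence differentiable in almost every direction by Rademacher, and
differentiability forces a single normal. Since `ρ_{L_t}(u)` is Lipschitz in `t` near `0`, uniformly
in `u`, one may differentiate under the integral (`tendsto_gaussianMeasure_slope`). The factor
multiplying `f(w)` is the Gaussian density times `ρ^(n-1) / (u · w)`.

It remains to see that `ρ^(n-1) / (u · w)` is the density of surface measure on `∂K` pulled back by
the radial map (`comap_boundaryPoint_euclideanHausdorffMeasure`). This is done by direct comparison.
Near a point with normal `v`, convexity keeps the part of `∂K` whose normals are close to `v` almost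
parallel to a hyperplane; central projection onto it is bi-Lipschitz with constant `k ^ 2`, and the
volume of cones relates the hyperplane to the sphere. Finitely many such patches cover the sphere,
and `k → 1` gives equality. It follows that points with several normals are negligible on `∂K`, so
the pushforward under `gaussMap K` is the Gaussian surface area measure. Uniqueness holds because
continuous functions separate finite Borel measures. -/

section SupportFunction

/-! ### Support functions and Wulff shapes. -/

variable {n : ℕ} (K : ConvexBody (EuclideanSpace ℝ (Fin n)))

lemma continuous_supportFunction : Continuous (supportFunction K) :=
  K.isCompact.continuous_sSup (f := fun y x => ⟪x, y⟫) (by fun_prop)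

lemma inner_le_supportFunction {x : EuclideanSpace ℝ (Fin n)} (hx : x ∈ K)
    (y : EuclideanSpace ℝ (Fin n)) : ⟪x, y⟫ ≤ supportFunction K y :=
  le_csSup (K.isCompact.image (f := fun x => ⟪x, y⟫) (by fun_prop)).bddAbove ⟨x, hx, rfl⟩

lemma supportFunction_le {y : EuclideanSpace ℝ (Fin n)} {c : ℝ} (h : ∀ x ∈ K, ⟪x, y⟫ ≤ c) :
    supportFunction K y ≤ c :=
  csSup_le (K.nonempty.image _) (by rintro _ ⟨x, hx, rfl⟩; exact h x hx)

/-- A point outside `K` is strictly separated from it by Hahn–Banach; the normalized separating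
vector is a direction whose constraint the point violates. -/
lemma wulffShape_supportFunction :
    wulffShape (fun v => supportFunction K v) = (K : Set (EuclideanSpace ℝ (Fin n))) := by
  refine Set.Subset.antisymm (fun x hx => ?_) fun x hx v => inner_le_supportFunction K hx v
  by_contra hxK
  obtain ⟨f, u, hf, hu⟩ := geometric_hahn_banach_closed_point K.convex K.isClosed hxK
  set w := (InnerProductSpace.toDual ℝ (EuclideanSpace ℝ (Fin n))).symm f with hw
  have hfw : ∀ y, f y = ⟪y, w⟫ := fun y => by
    rw [real_inner_comm, hw, InnerProductSpace.toDual_symm_apply]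
  have hw0 : w ≠ 0 := by
    rintro h0
    obtain ⟨a, ha⟩ := K.nonempty
    have := (hf a ha).trans hu
    simp [hfw, h0] at this
  have hpos : 0 < ‖w‖ := norm_pos_iff.2 hw0
  have h1 := hx ⟨‖w‖⁻¹ • w, by simp [norm_smul, hpos.ne']⟩
  have h2 : supportFunction K (‖w‖⁻¹ • w) ≤ ‖w‖⁻¹ * u := by
    refine supportFunction_le K fun y hy => ?_
    rw [real_inner_smul_right, ← hfw]
    exact mul_le_mul_of_nonneg_left (hf y hy).le (by positivity)
  have h3 : ‖w‖⁻¹ * u < ‖w‖⁻¹ * f x := mul_lt_mul_of_pos_left hu (by positivity)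
  simp only [real_inner_smul_right, ← hfw] at h1
  linarith

lemma convex_wulffShape (f : UnitSphere n → ℝ) : Convex ℝ (wulffShape f) := by
  intro x hx y hy a b ha hb hab v
  have := add_le_add (mul_le_mul_of_nonneg_left (hx v) ha) (mul_le_mul_of_nonneg_left (hy v) hb)
  rw [← add_mul, hab, one_mul] at this
  simpa [inner_add_left, real_inner_smul_left] using this

lemma isClosed_wulffShape (f : UnitSphere n → ℝ) : IsClosed (wulffShape f) := by
  simp only [wulffShape, Set.ofPred_forall]
  exact isClosed_iInter fun v => isClosed_le (by fun_prop) continuous_const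

lemma closedBall_subset_wulffShape {f : UnitSphere n → ℝ} {c : ℝ} (h : ∀ v, c ≤ f v) :
    Metric.closedBall 0 c ⊆ wulffShape f := by
  intro x hx v
  have h1 := real_inner_le_norm x (v : EuclideanSpace ℝ (Fin n))
  have h2 : ‖(v : EuclideanSpace ℝ (Fin n))‖ = 1 := by simp
  rw [h2, mul_one] at h1
  exact (h1.trans (by simpa using hx)).trans (h v)

lemma wulffShape_subset_closedBall {f : UnitSphere n → ℝ} {c : ℝ} (hc : 0 ≤ c)
    (h : ∀ v, f v ≤ c) : wulffShape f ⊆ Metric.closedBall 0 c := by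
  intro x hx
  rw [mem_closedBall_zero_iff]
  rcases eq_or_ne x 0 with rfl | hx0
  · simpa using hc
  have hpos : 0 < ‖x‖ := norm_pos_iff.2 hx0
  have h1 := hx ⟨‖x‖⁻¹ • x, by simp [norm_smul, hpos.ne']⟩
  simp only [real_inner_smul_right, real_inner_self_eq_norm_sq] at h1
  have : ‖x‖⁻¹ * ‖x‖ ^ 2 = ‖x‖ := by field_simp
  rw [this] at h1
  exact h1.trans (h _)

variable {K}

lemma exists_pos_le_supportFunction
    (hK : (0 : EuclideanSpace ℝ (Fin n)) ∈ interior (K : Set (EuclideanSpace ℝ (Fin n)))) :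
    ∃ r > 0, ∀ v : UnitSphere n, r ≤ supportFunction K v := by
  obtain ⟨r, hr, hrK⟩ := Metric.nhds_basis_closedBall.mem_iff.1 (mem_interior_iff_mem_nhds.1 hK)
  refine ⟨r, hr, fun v => ?_⟩
  have hv : ‖(v : EuclideanSpace ℝ (Fin n))‖ = 1 := by simp
  have := inner_le_supportFunction K (x := r • (v : EuclideanSpace ℝ (Fin n)))
    (hrK (by simp [norm_smul, abs_of_pos hr])) v
  rwa [real_inner_smul_left, real_inner_self_eq_norm_sq, hv, one_pow, mul_one] at this

/-- The gap `h_K(v) - x · v` attains its minimum on the compact sphere. Were the minimum positive,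
the ball of that radius about `x` would satisfy every constraint of the Wulff shape `K`, making `x`
interior. -/
lemma exists_isOuterUnitNormal [Nonempty (UnitSphere n)] {x : EuclideanSpace ℝ (Fin n)}
    (hx : x ∈ frontier (K : Set (EuclideanSpace ℝ (Fin n)))) :
    ∃ v, IsOuterUnitNormal K x v := by
  have hxK : x ∈ K := K.isClosed.frontier_subset hx
  have hcont : Continuous fun v : UnitSphere n => supportFunction K v - ⟪x, (v : EuclideanSpace ℝ (Fin n))⟫ :=
    ((continuous_supportFunction K).comp continuous_subtype_val).sub (by fun_prop)
  obtain ⟨v, -, hv⟩ := isCompact_univ.exists_isMinOn Set.univ_nonempty hcont.continuousOn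
  refine ⟨v, hxK, ?_⟩
  by_contra hne
  have hpos : 0 < supportFunction K v - ⟪x, (v : EuclideanSpace ℝ (Fin n))⟫ :=
    sub_pos.2 (lt_of_le_of_ne (inner_le_supportFunction K hxK v) hne)
  refine hx.2 (mem_interior_iff_mem_nhds.2 (mem_of_superset (Metric.closedBall_mem_nhds x hpos) ?_))
  intro z hz
  rw [← wulffShape_supportFunction]
  intro w
  have h1 : supportFunction K v - ⟪x, (v : EuclideanSpace ℝ (Fin n))⟫ ≤
    supportFunction K w - ⟪x, (w : EuclideanSpace ℝ (Fin n))⟫ := hv (Set.mem_univ w)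
  have h2 := real_inner_le_norm (z - x) (w : EuclideanSpace ℝ (Fin n))
  have h3 : ‖(w : EuclideanSpace ℝ (Fin n))‖ = 1 := by simp
  rw [h3, mul_one, inner_sub_left] at h2
  rw [mem_closedBall_iff_norm] at hz
  linarith

end SupportFunction

/-! ### Radial parametrization of the boundary and the Gauss map. -/

section RadialBoundary

variable {n : ℕ} (K : ConvexBody (EuclideanSpace ℝ (Fin n)))

/-- The boundary point of `K` in the direction `u`. -/
noncomputable def boundaryPoint (u : UnitSphere n) : EuclideanSpace ℝ (Fin n) :=
  (gauge (K : Set (EuclideanSpace ℝ (Fin n))) u)⁻¹ • (u : EuclideanSpace ℝ (Fin n))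

/-- The normalized gradient of the gauge of `K`: wherever the gauge is differentiable, this is the
outer unit normal of `K` at `boundaryPoint K u`. -/
noncomputable def gaussMap (u : UnitSphere n) : UnitSphere n :=
  open Classical in
  ⟨if gradient (gauge (K : Set (EuclideanSpace ℝ (Fin n)))) u = 0 then u else
    ‖gradient (gauge (K : Set (EuclideanSpace ℝ (Fin n)))) u‖⁻¹ •
      gradient (gauge (K : Set (EuclideanSpace ℝ (Fin n)))) u, by
    split_ifs with h
    · exact u.2
    · simp [norm_smul, h]⟩

lemma measurable_gaussMap : Measurable (gaussMap K) := by
  have hg : Measurable fun u : UnitSphere n =>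
      gradient (gauge (K : Set (EuclideanSpace ℝ (Fin n)))) u :=
    ((InnerProductSpace.toDual ℝ (EuclideanSpace ℝ (Fin n))).symm.continuous.measurable.comp
      (measurable_fderiv ℝ _)).comp measurable_subtype_coe
  refine Measurable.subtype_mk (Measurable.ite (hg (measurableSet_singleton 0))
    measurable_subtype_coe (hg.norm.inv.smul hg))

variable {K}
variable (hK : (0 : EuclideanSpace ℝ (Fin n)) ∈ interior (K : Set (EuclideanSpace ℝ (Fin n))))

include hK

lemma gauge_convexBody_pos {x : EuclideanSpace ℝ (Fin n)} (hx : x ≠ 0) :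
    0 < gauge (K : Set (EuclideanSpace ℝ (Fin n))) x :=
  (gauge_pos (absorbent_nhds_zero (mem_interior_iff_mem_nhds.1 hK))
    (NormedSpace.isVonNBounded_of_isBounded ℝ K.isBounded)).2 hx

lemma continuous_gauge_convexBody : Continuous (gauge (K : Set (EuclideanSpace ℝ (Fin n)))) :=
  continuous_gauge K.convex (mem_interior_iff_mem_nhds.1 hK)

lemma gauge_sphere_pos (u : UnitSphere n) :
    0 < gauge (K : Set (EuclideanSpace ℝ (Fin n))) u :=
  gauge_convexBody_pos hK (ne_zero_of_mem_unit_sphere u)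

lemma norm_boundaryPoint (u : UnitSphere n) :
    ‖boundaryPoint K u‖ = (gauge (K : Set (EuclideanSpace ℝ (Fin n))) u)⁻¹ := by
  simp [boundaryPoint, norm_smul, abs_of_pos (gauge_sphere_pos hK u)]

lemma norm_boundaryPoint_pos (u : UnitSphere n) : 0 < ‖boundaryPoint K u‖ := by
  rw [norm_boundaryPoint hK]
  exact inv_pos.2 (gauge_sphere_pos hK u)

lemma boundaryPoint_eq_norm_smul (u : UnitSphere n) :
    boundaryPoint K u = ‖boundaryPoint K u‖ • (u : EuclideanSpace ℝ (Fin n)) := by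
  rw [norm_boundaryPoint hK, boundaryPoint]

lemma continuous_boundaryPoint : Continuous (boundaryPoint K) :=
  (((continuous_gauge_convexBody hK).comp continuous_subtype_val).inv₀
    fun u => (gauge_sphere_pos hK u).ne').smul continuous_subtype_val

lemma injective_boundaryPoint : Function.Injective (boundaryPoint K) := by
  intro u v h
  have h1 := boundaryPoint_eq_norm_smul hK u
  rw [h, boundaryPoint_eq_norm_smul hK v, norm_smul, norm_norm, norm_eq_of_mem_sphere, mul_one] at h1
  exact Subtype.ext (smul_right_injective _ (norm_boundaryPoint_pos hK v).ne' h1).symm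

lemma boundaryPoint_mem_frontier (u : UnitSphere n) :
    boundaryPoint K u ∈ frontier (K : Set (EuclideanSpace ℝ (Fin n))) := by
  rw [← gauge_eq_one_iff_mem_frontier K.convex (mem_interior_iff_mem_nhds.1 hK), boundaryPoint,
    gauge_smul_of_nonneg (inv_nonneg.2 (gauge_nonneg _)), smul_eq_mul,
    inv_mul_cancel₀ (gauge_sphere_pos hK u).ne']

lemma range_boundaryPoint :
    Set.range (boundaryPoint K) = frontier (K : Set (EuclideanSpace ℝ (Fin n))) := by
  refine Set.Subset.antisymm ?_ fun x hx => ?_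
  · rintro _ ⟨u, rfl⟩
    exact boundaryPoint_mem_frontier hK u
  have hx0 : x ≠ 0 := by
    rintro rfl
    exact hx.2 hK
  have hpos : 0 < ‖x‖ := norm_pos_iff.2 hx0
  refine ⟨⟨‖x‖⁻¹ • x, by simp [norm_smul, hpos.ne']⟩, ?_⟩
  have h1 := (gauge_eq_one_iff_mem_frontier K.convex (mem_interior_iff_mem_nhds.1 hK)).2 hx
  simp only [boundaryPoint]
  rw [gauge_smul_of_nonneg (inv_nonneg.2 hpos.le), h1, smul_smul]
  simp [hpos.ne']

lemma measurableEmbedding_boundaryPoint : MeasurableEmbedding (boundaryPoint K) :=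
  ((continuous_boundaryPoint hK).isClosedEmbedding
    (injective_boundaryPoint hK)).measurableEmbedding

lemma inner_le_gauge_mul_supportFunction (z w : EuclideanSpace ℝ (Fin n)) :
    ⟪z, w⟫ ≤ gauge (K : Set (EuclideanSpace ℝ (Fin n))) z * supportFunction K w := by
  rcases eq_or_ne z 0 with rfl | hz
  · simp
  have hpos := gauge_convexBody_pos hK hz
  have hmem : (gauge (K : Set (EuclideanSpace ℝ (Fin n))) z)⁻¹ • z ∈ K := by
    have : (gauge (K : Set (EuclideanSpace ℝ (Fin n))) z)⁻¹ • z ∈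
        closure (K : Set (EuclideanSpace ℝ (Fin n))) := by
      rw [← gauge_le_one_iff_mem_closure K.convex (mem_interior_iff_mem_nhds.1 hK),
        gauge_smul_of_nonneg (inv_nonneg.2 hpos.le), smul_eq_mul, inv_mul_cancel₀ hpos.ne']
    rwa [K.isClosed.closure_eq] at this
  have h1 := inner_le_supportFunction K hmem w
  rw [real_inner_smul_left, inv_mul_le_iff₀ hpos] at h1
  exact h1

lemma supportFunction_sphere_pos (w : UnitSphere n) : 0 < supportFunction K w := by
  obtain ⟨r, hr, h⟩ := exists_pos_le_supportFunction hK
  exact hr.trans_le (h w)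

/-- The function `z ↦ gauge K z * h_K(w) - z · w` is nonnegative and vanishes at `u`, so its
derivative there is zero: the gradient of the gauge is `w / h_K(w)`. Differentiability thus forces
the normal to be unique. -/
lemma eq_gaussMap_of_isOuterUnitNormal {u w : UnitSphere n}
    (hd : DifferentiableAt ℝ (gauge (K : Set (EuclideanSpace ℝ (Fin n)))) u)
    (hw : IsOuterUnitNormal K (boundaryPoint K u) w) : w = gaussMap K u := by
  have hh := supportFunction_sphere_pos hK w
  have hwn : ‖(w : EuclideanSpace ℝ (Fin n))‖ = 1 := norm_eq_of_mem_sphere w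
  have hgrad : gradient (gauge (K : Set (EuclideanSpace ℝ (Fin n)))) u =
      (supportFunction K w)⁻¹ • (w : EuclideanSpace ℝ (Fin n)) := by
    have hder := (hd.hasFDerivAt.mul_const (supportFunction K w)).sub
      ((innerSL ℝ (w : EuclideanSpace ℝ (Fin n))).hasFDerivAt)
    have h0 : gauge (K : Set (EuclideanSpace ℝ (Fin n))) u * supportFunction K w -
        ⟪(w : EuclideanSpace ℝ (Fin n)), (u : EuclideanSpace ℝ (Fin n))⟫ = 0 := by
      have := hw.2
      rw [boundaryPoint, real_inner_smul_left, inv_mul_eq_iff_eq_mul₀ (gauge_sphere_pos hK u).ne'] at this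
      rw [real_inner_comm, this, sub_self]
    have hmin : IsLocalMin ((fun z => gauge (K : Set (EuclideanSpace ℝ (Fin n))) z *
        supportFunction K w) - ⇑(innerSL ℝ (w : EuclideanSpace ℝ (Fin n)))) u := by
      refine Eventually.of_forall fun z => ?_
      simp only [Pi.sub_apply, innerSL_apply_apply]
      rw [h0, real_inner_comm]
      exact sub_nonneg.2 (inner_le_gauge_mul_supportFunction hK z w)
    have hz := hmin.hasFDerivAt_eq_zero hder
    refine ext_inner_right ℝ fun z => ?_
    have hzz := congrArg (fun L : EuclideanSpace ℝ (Fin n) →L[ℝ] ℝ => L z) hz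
    simp only [gradient, InnerProductSpace.toDual_symm_apply]
    simp only [sub_apply, smul_apply, innerSL_apply_apply,
      zero_apply, smul_eq_mul] at hzz
    rw [real_inner_smul_left]
    field_simp
    linarith
  have hne : gradient (gauge (K : Set (EuclideanSpace ℝ (Fin n)))) u ≠ 0 := by
    rw [hgrad]
    exact smul_ne_zero (inv_ne_zero hh.ne') (ne_zero_of_mem_unit_sphere w)
  apply Subtype.ext
  simp only [gaussMap, if_neg hne]
  rw [hgrad, norm_smul, hwn, norm_inv, Real.norm_of_nonneg hh.le, mul_one, inv_inv, smul_smul,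
    mul_inv_cancel₀ hh.ne', one_smul]

lemma isOuterUnitNormal_gaussMap {u : UnitSphere n}
    (hd : DifferentiableAt ℝ (gauge (K : Set (EuclideanSpace ℝ (Fin n)))) u) :
    IsOuterUnitNormal K (boundaryPoint K u) (gaussMap K u) := by
  have : Nonempty (UnitSphere n) := ⟨u⟩
  obtain ⟨w, hw⟩ := exists_isOuterUnitNormal (boundaryPoint_mem_frontier hK u)
  exact eq_gaussMap_of_isOuterUnitNormal hK hd hw ▸ hw

-- Rademacher's theorem applies to the Lipschitz gauge on the whole space. By homogeneity the bad
-- set is a cone, and the spherical measure is a multiple of the volume of the cone over a set.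
open scoped Pointwise in
lemma ae_differentiableAt_gauge :
    ∀ᵐ u : UnitSphere n ∂(volume : Measure (EuclideanSpace ℝ (Fin n))).toSphere,
    DifferentiableAt ℝ (gauge (K : Set (EuclideanSpace ℝ (Fin n)))) (u : EuclideanSpace ℝ (Fin n)) := by
  obtain ⟨C, hC⟩ := K.convex.lipschitz_gauge (mem_interior_iff_mem_nhds.1 hK)
  have hae := hC.ae_differentiableAt (μ := volume)
  have hmeas := measurableSet_of_differentiableAt ℝ (gauge (K : Set (EuclideanSpace ℝ (Fin n))))
  rw [ae_iff] at hae ⊢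
  have hmeas' : MeasurableSet {u : UnitSphere n | ¬ DifferentiableAt ℝ
      (gauge (K : Set (EuclideanSpace ℝ (Fin n)))) (u : EuclideanSpace ℝ (Fin n))} :=
    (measurable_subtype_coe hmeas).compl
  rw [Measure.toSphere_apply' _ hmeas']
  have key : volume (Set.Ioo (0 : ℝ) 1 • ((fun u : UnitSphere n => (u : EuclideanSpace ℝ (Fin n))) ''
      {u | ¬ DifferentiableAt ℝ (gauge (K : Set (EuclideanSpace ℝ (Fin n))))
        (u : EuclideanSpace ℝ (Fin n))})) = 0 := by
    refine measure_mono_null ?_ hae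
    rintro _ ⟨s, hs, _, ⟨u, hu, rfl⟩, rfl⟩ hd
    refine hu ?_
    simp only at hd
    have heq : gauge (K : Set (EuclideanSpace ℝ (Fin n))) =
        fun x => s⁻¹ * gauge (K : Set (EuclideanSpace ℝ (Fin n))) (s • x) := by
      ext x
      rw [gauge_smul_of_nonneg hs.1.le, smul_eq_mul, inv_mul_cancel_left₀ hs.1.ne']
    rw [heq]
    refine DifferentiableAt.const_mul ?_ _
    exact DifferentiableAt.comp (g := gauge (K : Set (EuclideanSpace ℝ (Fin n))))
      (f := fun x => s • x) _ hd (by fun_prop)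
  exact mul_eq_zero_of_right _ key

end RadialBoundary

/-! ### Gaussian measure in polar coordinates. -/

section PolarCoordinates

lemma lintegral_eq_lintegral_toSphere {n : ℕ} (hn : 1 ≤ n)
    {F : EuclideanSpace ℝ (Fin n) → ℝ≥0∞} (hF : Measurable F) :
    ∫⁻ x, F x = ∫⁻ u : UnitSphere n, (∫⁻ s in Set.Ioi (0 : ℝ),
      ENNReal.ofReal (s ^ (n - 1)) * F (s • (u : EuclideanSpace ℝ (Fin n))))
      ∂(volume : Measure (EuclideanSpace ℝ (Fin n))).toSphere := by
  have : NeZero n := ⟨by omega⟩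
  have : Nontrivial (EuclideanSpace ℝ (Fin n)) := inferInstance
  have hmp := (volume : Measure (EuclideanSpace ℝ (Fin n))).measurePreserving_homeomorphUnitSphereProd
  rw [finrank_euclideanSpace_fin] at hmp
  have hG : Measurable fun p : UnitSphere n × Set.Ioi (0 : ℝ) =>
      F ((p.2 : ℝ) • (p.1 : EuclideanSpace ℝ (Fin n))) := by fun_prop
  calc ∫⁻ x, F x = ∫⁻ x : ({(0)}ᶜ : Set (EuclideanSpace ℝ (Fin n))), F (x : EuclideanSpace ℝ (Fin n)) ∂(volume.comap (Subtype.val)) := by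
        rw [lintegral_subtype_comap (measurableSet_singleton _).compl, restrict_compl_singleton]
    _ = ∫⁻ p, F ((p.2 : ℝ) • (p.1 : EuclideanSpace ℝ (Fin n)))
          ∂((volume : Measure (EuclideanSpace ℝ (Fin n))).toSphere.prod
            (Measure.volumeIoiPow (n - 1))) := by
        rw [← hmp.lintegral_comp hG]
        refine lintegral_congr fun x => ?_
        have hx : ‖(x : EuclideanSpace ℝ (Fin n))‖ ≠ 0 := norm_ne_zero_iff.2 x.2
        simp [smul_smul, hx]
    _ = _ := by
        rw [lintegral_prod _ hG.aemeasurable]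
        refine lintegral_congr fun u => ?_
        rw [Measure.volumeIoiPow, lintegral_withDensity_eq_lintegral_mul _ (by fun_prop)
          (by fun_prop), ← lintegral_subtype_comap measurableSet_Ioi]
        rfl

/-- The mass of `[0, R]` for the radial density `s ^ (n - 1) * exp (-s ^ 2 / 2)`. -/
noncomputable def radialMass (n : ℕ) (R : ℝ) : ℝ :=
  ∫ s in (0 : ℝ)..R, s ^ (n - 1) * Real.exp (-s ^ 2 / 2)

lemma hasDerivAt_radialMass (n : ℕ) (R : ℝ) :
    HasDerivAt (radialMass n) (R ^ (n - 1) * Real.exp (-R ^ 2 / 2)) R := by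
  have hc : Continuous fun s : ℝ => s ^ (n - 1) * Real.exp (-s ^ 2 / 2) := by fun_prop
  exact (hc.integral_hasStrictDerivAt 0 R).hasDerivAt

lemma continuous_radialMass (n : ℕ) : Continuous (radialMass n) :=
  continuous_iff_continuousAt.2 fun R => (hasDerivAt_radialMass n R).continuousAt

lemma radialMass_nonneg (n : ℕ) {R : ℝ} (hR : 0 ≤ R) : 0 ≤ radialMass n R :=
  intervalIntegral.integral_nonneg hR fun _ hs => mul_nonneg (pow_nonneg hs.1 _) (Real.exp_pos _).le

lemma setLIntegral_Ioc_radial (n : ℕ) {c R : ℝ} (hc : 0 ≤ c) (hR : 0 ≤ R) :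
    ∫⁻ s in Set.Ioc 0 R, ENNReal.ofReal (s ^ (n - 1)) * ENNReal.ofReal (c * Real.exp (-s ^ 2 / 2)) =
      ENNReal.ofReal (c * radialMass n R) := by
  have hcont : Continuous fun s : ℝ => c * (s ^ (n - 1) * Real.exp (-s ^ 2 / 2)) := by fun_prop
  rw [radialMass, ← intervalIntegral.integral_const_mul, intervalIntegral.integral_of_le hR,
    ofReal_integral_eq_lintegral_ofReal]
  · refine setLIntegral_congr_fun measurableSet_Ioc fun s hs => ?_
    rw [← ENNReal.ofReal_mul (pow_nonneg hs.1.le _)]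
    congr 1
    ring
  · exact (hcont.intervalIntegrable 0 R).1
  · filter_upwards [ae_restrict_mem measurableSet_Ioc] with s hs
    have := pow_nonneg hs.1.le (n - 1)
    simp only [Pi.zero_apply]
    positivity

/-- The ray through `u` meets `L` exactly in the parameters `s ≤ (gauge L u)⁻¹`. -/
lemma gaussianMeasure_real_eq_integral_toSphere {n : ℕ} (hn : 1 ≤ n)
    {L : Set (EuclideanSpace ℝ (Fin n))} (hconv : Convex ℝ L) (hclosed : IsClosed L)
    (h0 : L ∈ 𝓝 0) (hb : Bornology.IsBounded L) :
    (gaussianMeasure n).real L = ∫ u : UnitSphere n,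
      1 / (√(2 * Real.pi)) ^ n * radialMass n (gauge L u)⁻¹
      ∂(volume : Measure (EuclideanSpace ℝ (Fin n))).toSphere := by
  set c : ℝ := 1 / (√(2 * Real.pi)) ^ n with hc
  have hc0 : 0 ≤ c := by positivity
  have hpos : ∀ u : UnitSphere n, 0 < gauge L u := fun u =>
    (gauge_pos (absorbent_nhds_zero h0) (NormedSpace.isVonNBounded_of_isBounded ℝ hb)).2
      (ne_zero_of_mem_unit_sphere u)
  have hdens : Measurable fun x : EuclideanSpace ℝ (Fin n) =>
      ENNReal.ofReal (c * Real.exp (-‖x‖ ^ 2 / 2)) := by fun_prop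
  have hcont : Continuous fun u : UnitSphere n => c * radialMass n (gauge L u)⁻¹ :=
    continuous_const.mul ((continuous_radialMass n).comp
      (((continuous_gauge hconv h0).comp continuous_subtype_val).inv₀ fun u => (hpos u).ne'))
  rw [integral_eq_lintegral_of_nonneg_ae, Measure.real, gaussianMeasure,
    withDensity_apply _ hclosed.measurableSet, ← lintegral_indicator hclosed.measurableSet,
    lintegral_eq_lintegral_toSphere hn (hdens.indicator hclosed.measurableSet)]
  · congr 1
    refine lintegral_congr fun u => ?_
    rw [← setLIntegral_Ioc_radial n hc0 (inv_nonneg.2 (hpos u).le),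
      ← Set.Ioi_inter_Iic, ← Measure.restrict_restrict_of_subset Set.inter_subset_left,
      Set.inter_comm, ← Set.inter_comm (Set.Ioi (0 : ℝ)), ← lintegral_indicator
        (measurableSet_Ioi.inter measurableSet_Iic)]
    refine setLIntegral_congr_fun measurableSet_Ioi fun s hs => ?_
    have hs' : 0 < s := hs
    have hmem : s • (u : EuclideanSpace ℝ (Fin n)) ∈ L ↔ s ≤ (gauge L u)⁻¹ := by
      rw [← hclosed.closure_eq, ← gauge_le_one_iff_mem_closure hconv h0, hclosed.closure_eq,
        gauge_smul_of_nonneg hs'.le, smul_eq_mul, le_inv_comm₀ hs' (hpos u),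
        ← le_div_iff₀' hs', one_div]
    by_cases h : s ≤ (gauge L u)⁻¹
    · have h2 : s ∈ Set.Ioi 0 ∩ Set.Iic (gauge L (u : EuclideanSpace ℝ (Fin n)))⁻¹ := ⟨hs, h⟩
      simp only [Set.indicator_of_mem (hmem.2 h), Set.indicator_of_mem h2, norm_smul,
        Real.norm_of_nonneg hs'.le, norm_eq_of_mem_sphere, mul_one]
    · have h2 : s ∉ Set.Ioi 0 ∩ Set.Iic (gauge L (u : EuclideanSpace ℝ (Fin n)))⁻¹ := fun h' => h h'.2
      rw [Set.indicator_of_notMem (fun h' => h (hmem.1 h')), Set.indicator_of_notMem h2, mul_zero]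
  · exact Eventually.of_forall fun u =>
      mul_nonneg hc0 (radialMass_nonneg n (inv_nonneg.2 (hpos u).le))
  · exact hcont.aestronglyMeasurable

end PolarCoordinates

/-! ### Radial functions of Wulff shapes. -/

section RadialFunction

variable {n : ℕ}

lemma wulffShape_mem_nhds_zero {g : UnitSphere n → ℝ} {c : ℝ} (hc : 0 < c) (h : ∀ v, c ≤ g v) :
    wulffShape g ∈ 𝓝 0 :=
  mem_of_superset (Metric.closedBall_mem_nhds 0 hc) (closedBall_subset_wulffShape h)

lemma isBounded_wulffShape {g : UnitSphere n → ℝ} {C : ℝ} (hC : 0 ≤ C) (h : ∀ v, g v ≤ C) :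
    Bornology.IsBounded (wulffShape g) :=
  Metric.isBounded_closedBall.subset (wulffShape_subset_closedBall hC h)

lemma gauge_wulffShape_pos {g : UnitSphere n → ℝ} {c C : ℝ} (hc : 0 < c)
    (h : ∀ v, g v ∈ Set.Icc c C) (u : UnitSphere n) : 0 < gauge (wulffShape g) u :=
  (gauge_pos (absorbent_nhds_zero (wulffShape_mem_nhds_zero hc fun v => (h v).1))
    (NormedSpace.isVonNBounded_of_isBounded ℝ (isBounded_wulffShape
      (hc.le.trans ((h u).1.trans (h u).2)) fun v => (h v).2))).2 (ne_zero_of_mem_unit_sphere u)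

/-- Membership of `s • u` in the Wulff shape, read in two ways. Bounds on radial functions thereby
become families of linear inequalities in `v`. -/
lemma le_inv_gauge_wulffShape_iff {g : UnitSphere n → ℝ} {c C : ℝ} (hc : 0 < c)
    (h : ∀ v, g v ∈ Set.Icc c C) (u : UnitSphere n) {s : ℝ} (hs : 0 ≤ s) :
    s ≤ (gauge (wulffShape g) u)⁻¹ ↔
      ∀ v : UnitSphere n, s * ⟪(u : EuclideanSpace ℝ (Fin n)), (v : EuclideanSpace ℝ (Fin n))⟫ ≤ g v := by
  have hpos := gauge_wulffShape_pos hc h u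
  have h0 := wulffShape_mem_nhds_zero hc fun v => (h v).1
  have hmem : s • (u : EuclideanSpace ℝ (Fin n)) ∈ wulffShape g ↔
      s ≤ (gauge (wulffShape g) u)⁻¹ := by
    rw [← (isClosed_wulffShape g).closure_eq, ← gauge_le_one_iff_mem_closure (convex_wulffShape g) h0,
      (isClosed_wulffShape g).closure_eq, gauge_smul_of_nonneg hs, smul_eq_mul, ← le_div_iff₀ hpos,
      one_div]
  rw [← hmem]
  simp only [wulffShape, Set.mem_ofPred_eq, real_inner_smul_left]

lemma inv_gauge_wulffShape_le {g : UnitSphere n → ℝ} {c C : ℝ} (hc : 0 < c)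
    (h : ∀ v, g v ∈ Set.Icc c C) (u : UnitSphere n) : (gauge (wulffShape g) u)⁻¹ ≤ C := by
  have h1 := (le_inv_gauge_wulffShape_iff hc h u
    (inv_nonneg.2 (gauge_wulffShape_pos hc h u).le)).1 le_rfl u
  rw [real_inner_self_eq_norm_sq, norm_eq_of_mem_sphere, one_pow, mul_one] at h1
  exact h1.trans (h u).2

/-- Shrinking `[g₁]` by `1 - δ / c` lowers each constraint by `(δ / c) g₁ ≥ δ`, which places it
inside `[g₂]`. -/
lemma inv_gauge_wulffShape_sub_le {g₁ g₂ : UnitSphere n → ℝ} {c C δ : ℝ} (hc : 0 < c)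
    (h₁ : ∀ v, g₁ v ∈ Set.Icc c C) (h₂ : ∀ v, g₂ v ∈ Set.Icc c C) (hδ : ∀ v, |g₁ v - g₂ v| ≤ δ)
    (u : UnitSphere n) :
    (gauge (wulffShape g₁) u)⁻¹ - (gauge (wulffShape g₂) u)⁻¹ ≤ C / c * δ := by
  have hC : 0 ≤ C := hc.le.trans ((h₁ u).1.trans (h₁ u).2)
  have hδ0 : 0 ≤ δ := (abs_nonneg _).trans (hδ u)
  have hρ₁ := inv_nonneg.2 (gauge_wulffShape_pos hc h₁ u).le
  have hρ₂ := inv_nonneg.2 (gauge_wulffShape_pos hc h₂ u).le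
  have hle := inv_gauge_wulffShape_le hc h₁ u
  rcases le_or_gt δ c with hδc | hδc
  · have h1δ : 0 ≤ 1 - δ / c := sub_nonneg.2 ((div_le_one hc).2 hδc)
    have key : (1 - δ / c) * (gauge (wulffShape g₁) u)⁻¹ ≤ (gauge (wulffShape g₂) u)⁻¹ := by
      rw [le_inv_gauge_wulffShape_iff hc h₂ u (mul_nonneg h1δ hρ₁)]
      intro v
      have h3 := (le_inv_gauge_wulffShape_iff hc h₁ u hρ₁).1 le_rfl v
      have h4 := mul_le_mul_of_nonneg_left h3 h1δ
      have h5 : δ ≤ δ / c * g₁ v := by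
        rw [div_mul_eq_mul_div, le_div_iff₀ hc]
        exact mul_le_mul_of_nonneg_left (h₁ v).1 hδ0
      have h6 := (abs_le.1 (hδ v)).2
      rw [mul_assoc]
      linarith
    have h7 : δ / c * (gauge (wulffShape g₁) u)⁻¹ ≤ δ / c * C :=
      mul_le_mul_of_nonneg_left hle (by positivity)
    have h8 : δ / c * C = C / c * δ := by ring
    linarith
  -- For `δ > c` the claim is weaker than the bound of the radial function by `C`.
  · have : C * 1 ≤ C * (δ / c) := mul_le_mul_of_nonneg_left ((one_le_div hc).2 hδc.le) hC
    have h8 : C * (δ / c) = C / c * δ := by ring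
    linarith

lemma abs_inv_gauge_wulffShape_sub_le {g₁ g₂ : UnitSphere n → ℝ} {c C δ : ℝ} (hc : 0 < c)
    (h₁ : ∀ v, g₁ v ∈ Set.Icc c C) (h₂ : ∀ v, g₂ v ∈ Set.Icc c C) (hδ : ∀ v, |g₁ v - g₂ v| ≤ δ)
    (u : UnitSphere n) :
    |(gauge (wulffShape g₁) u)⁻¹ - (gauge (wulffShape g₂) u)⁻¹| ≤ C / c * δ :=
  abs_sub_le_iff.2 ⟨inv_gauge_wulffShape_sub_le hc h₁ h₂ hδ u,
    inv_gauge_wulffShape_sub_le hc h₂ h₁ (fun v => abs_sub_comm (g₁ v) (g₂ v) ▸ hδ v) u⟩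

/-- Only the compact set `{b ≤ 0}` matters; there `a` has a positive minimum and `b` is bounded
below, so one small `t` serves all `x`. -/
lemma eventually_forall_nonneg_add_mul {X : Type*} [TopologicalSpace X] [CompactSpace X]
    {a b : X → ℝ} (ha : Continuous a) (hb : Continuous b) (ha0 : ∀ x, 0 ≤ a x)
    (hab : ∀ x, a x = 0 → 0 < b x) : ∀ᶠ t in 𝓝[>] (0 : ℝ), ∀ x, 0 ≤ a x + t * b x := by
  have hcpt : IsCompact {x | b x ≤ 0} := (isClosed_le hb continuous_const).isCompact
  obtain ⟨B, hB⟩ := isCompact_univ.exists_bound_of_continuousOn hb.continuousOn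
  rcases Set.eq_empty_or_nonempty {x | b x ≤ 0} with he | hne
  · filter_upwards [self_mem_nhdsWithin] with t ht x
    have : 0 < b x := not_le.1 fun h => (he ▸ (show x ∈ {x | b x ≤ 0} from h) : x ∈ (∅ : Set X))
    exact add_nonneg (ha0 x) (mul_nonneg (le_of_lt ht) this.le)
  obtain ⟨y, hy, hmin⟩ := hcpt.exists_isMinOn hne ha.continuousOn
  have hm : 0 < a y := lt_of_le_of_ne (ha0 y) fun h => absurd (hab y h.symm) (not_lt.2 hy)
  have hB0 : 0 ≤ B := (norm_nonneg _).trans (hB y (Set.mem_univ _))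
  have hlt : 0 < a y / (B + 1) := by positivity
  filter_upwards [Ioo_mem_nhdsGT hlt] with t ht x
  rcases le_or_gt (b x) 0 with hx | hx
  · have h1 : a y ≤ a x := hmin hx
    have h2 := (abs_le.1 (hB x (Set.mem_univ _))).1
    have h3 := (lt_div_iff₀ (by positivity)).1 ht.2
    have h4 : t * -B ≤ t * b x := mul_le_mul_of_nonneg_left h2 ht.1.le
    have h5 := ht.1
    linarith
  · exact add_nonneg (ha0 x) (mul_nonneg ht.1.le hx.le)

end RadialFunction

/-! ### Derivative of the radial function under perturbation. -/

section RadialDerivative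

variable {n : ℕ} {K : ConvexBody (EuclideanSpace ℝ (Fin n))}

lemma exists_forall_perturbation_mem_Icc
    (hK : (0 : EuclideanSpace ℝ (Fin n)) ∈ interior (K : Set (EuclideanSpace ℝ (Fin n))))
    (f : C(UnitSphere n, ℝ)) : ∃ c C M t₀ : ℝ, 0 < c ∧ 0 < C ∧ 0 < t₀ ∧ (∀ v, |f v| ≤ M) ∧
      ∀ t, |t| < t₀ → ∀ v : UnitSphere n, supportFunction K v + t * f v ∈ Set.Icc c C := by
  obtain ⟨r, hr, hrK⟩ := exists_pos_le_supportFunction hK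
  obtain ⟨M, hM⟩ := isCompact_univ.exists_bound_of_continuousOn f.continuous.continuousOn
  have hcont : Continuous fun v : UnitSphere n => supportFunction K v :=
    (continuous_supportFunction K).comp continuous_subtype_val
  obtain ⟨R, hR⟩ := isCompact_univ.exists_bound_of_continuousOn hcont.continuousOn
  refine ⟨r / 2, |R| + r / 2, |M|, r / 2 / (|M| + 1), by positivity, by positivity, by positivity,
    fun v => (hM v (Set.mem_univ _)).trans (le_abs_self M), fun t ht v => ?_⟩
  have h1 : |f v| ≤ |M| := (hM v (Set.mem_univ _)).trans (le_abs_self M)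
  have h2 : |t| * (|M| + 1) < r / 2 := (lt_div_iff₀ (by positivity)).1 ht
  have h3 : |t * f v| ≤ r / 2 := by
    rw [abs_mul]
    nlinarith [abs_nonneg t, abs_nonneg (f v)]
  have h4 := abs_le.1 h3
  have h5 := (le_abs_self _).trans ((hR v (Set.mem_univ _)).trans (le_abs_self R))
  have h6 := hrK v
  constructor <;> linarith

/-- The upper bound uses only the constraint at `w`. For the lower bound the point at radius `ρ + t
* (D - δ)` must satisfy all constraints: those at `v ≠ w` are slack at `t = 0`, while the one at `w`
gains slack at rate `δ (u · w) > 0`, so `eventually_forall_nonneg_add_mul` applies. -/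
lemma tendsto_right_slope_inv_gauge_wulffShape
    (hK : (0 : EuclideanSpace ℝ (Fin n)) ∈ interior (K : Set (EuclideanSpace ℝ (Fin n))))
    (f : C(UnitSphere n, ℝ)) {u w : UnitSphere n} (hw : IsOuterUnitNormal K (boundaryPoint K u) w)
    (huniq : ∀ v, IsOuterUnitNormal K (boundaryPoint K u) v → v = w) :
    Tendsto (fun t : ℝ => t⁻¹ * ((gauge (wulffShape fun v => supportFunction K v + t * f v) u)⁻¹ -
      (gauge (K : Set (EuclideanSpace ℝ (Fin n))) u)⁻¹)) (𝓝[>] 0)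
      (𝓝 (f w / ⟪(u : EuclideanSpace ℝ (Fin n)), (w : EuclideanSpace ℝ (Fin n))⟫)) := by
  obtain ⟨c, C, M, t₀, hc, hC, ht₀, -, hI⟩ := exists_forall_perturbation_mem_Icc hK f
  set ρ := (gauge (K : Set (EuclideanSpace ℝ (Fin n))) u)⁻¹ with hρ
  have hρpos : 0 < ρ := inv_pos.2 (gauge_sphere_pos hK u)
  have hinner : ∀ v : UnitSphere n, ⟪boundaryPoint K u, (v : EuclideanSpace ℝ (Fin n))⟫ =
      ρ * ⟪(u : EuclideanSpace ℝ (Fin n)), (v : EuclideanSpace ℝ (Fin n))⟫ := fun v => by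
    rw [boundaryPoint, real_inner_smul_left]
  have hw2 : ρ * ⟪(u : EuclideanSpace ℝ (Fin n)), (w : EuclideanSpace ℝ (Fin n))⟫ =
      supportFunction K w := (hinner w).symm.trans hw.2
  have huw : 0 < ⟪(u : EuclideanSpace ℝ (Fin n)), (w : EuclideanSpace ℝ (Fin n))⟫ :=
    (mul_pos_iff_of_pos_left hρpos).1 (hw2 ▸ supportFunction_sphere_pos hK w)
  set D := f w / ⟪(u : EuclideanSpace ℝ (Fin n)), (w : EuclideanSpace ℝ (Fin n))⟫ with hD
  have hDw : D * ⟪(u : EuclideanSpace ℝ (Fin n)), (w : EuclideanSpace ℝ (Fin n))⟫ = f w :=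
    div_mul_cancel₀ _ huw.ne'
  rw [Metric.tendsto_nhds]
  intro ε hε
  set δ := ε / 2 with hδdef
  have hδ : 0 < δ := by positivity
  have hsmall : ∀ᶠ t in 𝓝[>] (0 : ℝ), t < t₀ := nhdsWithin_le_nhds (Iio_mem_nhds ht₀)
  have hup : ∀ᶠ t in 𝓝[>] (0 : ℝ), 0 ≤ ρ + t * (D + δ) := by
    have : Tendsto (fun t : ℝ => ρ + t * (D + δ)) (𝓝[>] 0) (𝓝 (ρ + 0 * (D + δ))) :=
      ((by fun_prop : Continuous fun t : ℝ => ρ + t * (D + δ)).tendsto 0).mono_left nhdsWithin_le_nhds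
    rw [zero_mul, add_zero] at this
    exact (this.eventually (lt_mem_nhds hρpos)).mono fun _ h => h.le
  have hlo : ∀ᶠ t in 𝓝[>] (0 : ℝ), 0 ≤ ρ + t * (D - δ) := by
    have : Tendsto (fun t : ℝ => ρ + t * (D - δ)) (𝓝[>] 0) (𝓝 (ρ + 0 * (D - δ))) :=
      ((by fun_prop : Continuous fun t : ℝ => ρ + t * (D - δ)).tendsto 0).mono_left nhdsWithin_le_nhds
    rw [zero_mul, add_zero] at this
    exact (this.eventually (lt_mem_nhds hρpos)).mono fun _ h => h.le
  have hcontS : Continuous fun v : UnitSphere n => supportFunction K v :=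
    (continuous_supportFunction K).comp continuous_subtype_val
  have hmain := eventually_forall_nonneg_add_mul
    (a := fun v : UnitSphere n => supportFunction K v -
      ρ * ⟪(u : EuclideanSpace ℝ (Fin n)), (v : EuclideanSpace ℝ (Fin n))⟫)
    (b := fun v : UnitSphere n => f v -
      (D - δ) * ⟪(u : EuclideanSpace ℝ (Fin n)), (v : EuclideanSpace ℝ (Fin n))⟫)
    (by fun_prop) (by fun_prop)
    (fun v => by
      rw [← hinner]
      exact sub_nonneg.2 (inner_le_supportFunction K hw.1 v))
    (fun v hv => by
      have : v = w := huniq v ⟨hw.1, by rw [hinner]; linarith⟩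
      subst this
      have := mul_pos hδ huw
      linarith)
  filter_upwards [self_mem_nhdsWithin, hsmall, hup, hlo, hmain] with t ht htt₀ h1 h2 h3
  have ht' : 0 < t := ht
  have hIt := hI t (by rwa [abs_of_pos ht'])
  have hupper : (gauge (wulffShape fun v => supportFunction K v + t * f v) u)⁻¹ ≤ ρ + t * (D + δ) := by
    by_contra hcon
    have h4 := (le_inv_gauge_wulffShape_iff hc hIt u h1).1 (not_le.1 hcon).le w
    have h5 := mul_pos ht' (mul_pos hδ huw)
    have h6 : t * f w = t * (D * ⟪(u : EuclideanSpace ℝ (Fin n)), (w : EuclideanSpace ℝ (Fin n))⟫) := by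
      rw [hDw]
    linarith
  have hlower : ρ + t * (D - δ) ≤ (gauge (wulffShape fun v => supportFunction K v + t * f v) u)⁻¹ := by
    rw [le_inv_gauge_wulffShape_iff hc hIt u h2]
    intro v
    have := h3 v
    linarith
  rw [Real.dist_eq, abs_lt]
  constructor
  · have : D - δ ≤ t⁻¹ * ((gauge (wulffShape fun v => supportFunction K v + t * f v) u)⁻¹ - ρ) := by
      rw [le_inv_mul_iff₀ ht']
      linarith
    linarith
  · have : t⁻¹ * ((gauge (wulffShape fun v => supportFunction K v + t * f v) u)⁻¹ - ρ) ≤ D + δ := by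
      rw [inv_mul_le_iff₀ ht']
      linarith
    linarith

lemma hasDerivAt_inv_gauge_wulffShape
    (hK : (0 : EuclideanSpace ℝ (Fin n)) ∈ interior (K : Set (EuclideanSpace ℝ (Fin n))))
    (f : C(UnitSphere n, ℝ)) {u w : UnitSphere n} (hw : IsOuterUnitNormal K (boundaryPoint K u) w)
    (huniq : ∀ v, IsOuterUnitNormal K (boundaryPoint K u) v → v = w) :
    HasDerivAt (fun t : ℝ => (gauge (wulffShape fun v => supportFunction K v + t * f v) u)⁻¹)
      (f w / ⟪(u : EuclideanSpace ℝ (Fin n)), (w : EuclideanSpace ℝ (Fin n))⟫) 0 := by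
  rw [hasDerivAt_iff_tendsto_slope_zero, ← nhdsLT_sup_nhdsGT, tendsto_sup]
  simp only [zero_add, zero_mul, add_zero, smul_eq_mul, wulffShape_supportFunction]
  refine ⟨?_, tendsto_right_slope_inv_gauge_wulffShape hK f hw huniq⟩
  -- The left slope for `f` comes from the right slope for `-f`.
  have h := ((tendsto_right_slope_inv_gauge_wulffShape hK (-f) hw huniq).comp
    (by simpa using tendsto_neg_nhdsLT (a := (0 : ℝ)) : Tendsto Neg.neg (𝓝[<] (0 : ℝ)) (𝓝[>] 0))).neg
  simp only [ContinuousMap.coe_neg, Pi.neg_apply, neg_div, neg_neg] at h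
  refine h.congr fun t => ?_
  simp only [Function.comp_apply, inv_neg, neg_mul, mul_neg, neg_neg]

end RadialDerivative

/-! ### Differentiation under the integral sign. -/

section FirstVariation

variable {n : ℕ} {K : ConvexBody (EuclideanSpace ℝ (Fin n))}

/-- The density with respect to the spherical measure of the surface measure of `∂K`, pulled back
along `boundaryPoint K`. -/
noncomputable def boundaryJacobian (K : ConvexBody (EuclideanSpace ℝ (Fin n)))
    (u : UnitSphere n) : ℝ :=
  ‖boundaryPoint K u‖ ^ n /
    ⟪boundaryPoint K u, (gaussMap K u : EuclideanSpace ℝ (Fin n))⟫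

lemma measurable_boundaryJacobian
    (hK : (0 : EuclideanSpace ℝ (Fin n)) ∈ interior (K : Set (EuclideanSpace ℝ (Fin n)))) :
    Measurable (boundaryJacobian K) := by
  have h1 := (continuous_boundaryPoint hK).measurable
  have h2 := measurable_subtype_coe.comp (measurable_gaussMap K)
  exact (h1.norm.pow_const n).div (h1.inner h2)

lemma abs_radialMass_sub_le (n : ℕ) {C x y : ℝ} (hx : x ∈ Set.Icc 0 C) (hy : y ∈ Set.Icc 0 C) :
    |radialMass n x - radialMass n y| ≤ C ^ (n - 1) * |x - y| := by
  refine (convex_Icc 0 C).norm_image_sub_le_of_norm_hasDerivWithin_le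
    (fun s _ => (hasDerivAt_radialMass n s).hasDerivWithinAt) (fun s hs => ?_) hy hx
  have h1 : Real.exp (-s ^ 2 / 2) ≤ 1 := Real.exp_le_one_iff.2 (by nlinarith [sq_nonneg s])
  rw [Real.norm_of_nonneg (mul_nonneg (pow_nonneg hs.1 _) (Real.exp_pos _).le)]
  have h2 : s ^ (n - 1) ≤ C ^ (n - 1) := pow_le_pow_left₀ hs.1 hs.2 _
  calc s ^ (n - 1) * Real.exp (-s ^ 2 / 2) ≤ s ^ (n - 1) * 1 :=
        mul_le_mul_of_nonneg_left h1 (pow_nonneg hs.1 _)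
    _ ≤ C ^ (n - 1) := by rwa [mul_one]

lemma tendsto_gaussianMeasure_slope (hn : 1 ≤ n)
    (hK : (0 : EuclideanSpace ℝ (Fin n)) ∈ interior (K : Set (EuclideanSpace ℝ (Fin n))))
    (f : C(UnitSphere n, ℝ)) :
    Tendsto (fun t : ℝ =>
        ((gaussianMeasure n).real (wulffShape fun v => supportFunction K v + t * f v) -
          (gaussianMeasure n).real (K : Set (EuclideanSpace ℝ (Fin n)))) / t) (𝓝[≠] 0)
      (𝓝 (∫ u : UnitSphere n, 1 / (√(2 * Real.pi)) ^ n *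
        (Real.exp (-‖boundaryPoint K u‖ ^ 2 / 2) * boundaryJacobian K u) * f (gaussMap K u)
        ∂(volume : Measure (EuclideanSpace ℝ (Fin n))).toSphere)) := by
  obtain ⟨c, C, M, t₀, hc, hC, ht₀, hM, hI⟩ := exists_forall_perturbation_mem_Icc hK f
  set σ := (volume : Measure (EuclideanSpace ℝ (Fin n))).toSphere with hσ
  set a : ℝ := 1 / (√(2 * Real.pi)) ^ n with ha
  have ha0 : 0 ≤ a := by positivity
  set L : ℝ → Set (EuclideanSpace ℝ (Fin n)) :=
    fun t => wulffShape fun v => supportFunction K v + t * f v with hL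
  have hL0 : L 0 = K := by simp only [hL, zero_mul, add_zero, wulffShape_supportFunction]
  set F : ℝ → UnitSphere n → ℝ := fun t u => a * radialMass n (gauge (L t) u)⁻¹ with hF
  have hFcont : ∀ t, |t| < t₀ → Continuous (F t) := fun t ht =>
    continuous_const.mul ((continuous_radialMass n).comp
      (((continuous_gauge (convex_wulffShape _) (wulffShape_mem_nhds_zero hc
        fun v => (hI t ht v).1)).comp continuous_subtype_val).inv₀
        fun u => (gauge_wulffShape_pos hc (hI t ht) u).ne'))
  have hmeasure : ∀ t, |t| < t₀ → (gaussianMeasure n).real (L t) = ∫ u, F t u ∂σ := fun t ht =>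
    gaussianMeasure_real_eq_integral_toSphere hn (convex_wulffShape _) (isClosed_wulffShape _)
      (wulffShape_mem_nhds_zero hc fun v => (hI t ht v).1)
      (isBounded_wulffShape hC.le fun v => (hI t ht v).2)
  have h00 : |(0 : ℝ)| < t₀ := by simpa using ht₀
  have hder := (hasDerivAt_integral_of_dominated_loc_of_lip (μ := σ) (F := F) (x₀ := (0 : ℝ))
    (F' := fun u => a * (Real.exp (-‖boundaryPoint K u‖ ^ 2 / 2) * boundaryJacobian K u) *
      f (gaussMap K u)) (s := Metric.ball 0 t₀)
    -- A product of Lipschitz constants: `a` is the Gaussian prefactor, `C ^ (n - 1)` belongs to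
    -- `radialMass` on `[0, C]`, `C / c` to the radial function under uniform perturbation, and `M`
    -- bounds `f`.
    (bound := fun _ => a * (C ^ (n - 1) * (C / c * M))) (Metric.ball_mem_nhds 0 ht₀)
    (by
      filter_upwards [Metric.ball_mem_nhds (0 : ℝ) ht₀] with t ht
      exact (hFcont t (by simpa using ht)).aestronglyMeasurable)
    ((hFcont 0 h00).integrable_of_hasCompactSupport (HasCompactSupport.of_compactSpace _))
    (by
      refine Measurable.aestronglyMeasurable ?_
      have h1 := (continuous_boundaryPoint hK).measurable
      have h2 := measurable_boundaryJacobian hK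
      have h3 := f.continuous.measurable.comp (measurable_gaussMap K)
      exact (((((h1.norm.pow_const 2).neg.div_const 2).exp).mul h2).const_mul a).mul h3)
    (by
      refine Eventually.of_forall fun u => LipschitzOnWith.of_dist_le_mul fun s hs t ht => ?_
      have hs' := hI s (by simpa using hs)
      have ht' := hI t (by simpa using ht)
      have hM0 : 0 ≤ M := (abs_nonneg _).trans (hM u)
      have hb : 0 ≤ a * (C ^ (n - 1) * (C / c * M)) := by positivity
      rw [Real.coe_nnabs, abs_of_nonneg hb, Real.dist_eq, Real.dist_eq]
      have h1 := abs_radialMass_sub_le n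
        ⟨inv_nonneg.2 (gauge_wulffShape_pos hc hs' u).le, inv_gauge_wulffShape_le hc hs' u⟩
        ⟨inv_nonneg.2 (gauge_wulffShape_pos hc ht' u).le, inv_gauge_wulffShape_le hc ht' u⟩
      have h2 := abs_inv_gauge_wulffShape_sub_le (δ := M * |s - t|) hc hs' ht' (fun v => by
        rw [add_sub_add_left_eq_sub, ← sub_mul, abs_mul, mul_comm]
        exact mul_le_mul_of_nonneg_right (hM v) (abs_nonneg _)) u
      simp only [hF, hL]
      rw [← mul_sub, abs_mul, abs_of_nonneg ha0, mul_assoc]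
      refine mul_le_mul_of_nonneg_left (h1.trans ?_) ha0
      rw [mul_assoc, mul_assoc]
      exact mul_le_mul_of_nonneg_left h2 (by positivity))
    (integrable_const _)
    (by
      filter_upwards [ae_differentiableAt_gauge hK] with u hu
      have hw := isOuterUnitNormal_gaussMap hK hu
      have hd := hasDerivAt_inv_gauge_wulffShape hK f hw
        fun v hv => eq_gaussMap_of_isOuterUnitNormal hK hu hv
      have hcomp := ((hasDerivAt_radialMass n _).comp (0 : ℝ) hd).const_mul a
      refine hcomp.congr_deriv ?_
      simp only [zero_mul, add_zero, wulffShape_supportFunction]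
      rw [← norm_boundaryPoint hK u, boundaryJacobian]
      have hpos := norm_boundaryPoint_pos hK u
      set ρ := ‖boundaryPoint K u‖ with hρ
      rw [boundaryPoint_eq_norm_smul hK u, real_inner_smul_left, ← hρ]
      -- Writing `n = m + 1` turns `ρ ^ (n - 1) / (u · w)` into `ρ ^ n / (ρ u · w)`, the form of
      -- `boundaryJacobian`.
      obtain ⟨m, rfl⟩ := Nat.exists_eq_add_of_le' hn
      rw [Nat.add_sub_cancel, pow_succ ρ m, mul_comm ρ, mul_div_mul_right _ _ hpos.ne']
      ring)).2
  rw [hasDerivAt_iff_tendsto_slope_zero] at hder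
  refine hder.congr' ?_
  filter_upwards [nhdsWithin_le_nhds (Metric.ball_mem_nhds (0 : ℝ) ht₀)] with t ht
  rw [zero_add, ← hmeasure t (by simpa using ht), ← hmeasure 0 h00, hL0, smul_eq_mul, div_eq_inv_mul]

end FirstVariation

/-! ### Volumes of cones and central projection from the sphere to a hyperplane. -/

section Cones

open scoped Pointwise

variable {n : ℕ}

lemma lintegral_Ioo_div_pow {n : ℕ} (hn : 1 ≤ n) {h : ℝ} (hh : 0 < h) :
    ∫⁻ x in Set.Ioo 0 h, ENNReal.ofReal ((x / h) ^ (n - 1)) = ENNReal.ofReal (h / n) := by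
  have hcont : Continuous fun x : ℝ => (x / h) ^ (n - 1) := by fun_prop
  rw [Measure.restrict_congr_set Ioo_ae_eq_Ioc, ← ofReal_integral_eq_lintegral_ofReal
    (hcont.intervalIntegrable 0 h).1, ← intervalIntegral.integral_of_le hh.le,
    intervalIntegral.integral_comp_div (fun x => x ^ (n - 1)) hh.ne', integral_pow]
  · obtain ⟨m, rfl⟩ := Nat.exists_eq_add_of_le' hn
    congr 1
    simp [hh.ne', div_eq_mul_inv]
  · filter_upwards [ae_restrict_mem measurableSet_Ioc] with x hx
    exact pow_nonneg (div_nonneg hx.1.le hh.le) _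

lemma mem_Ioo_smul_iff_of_subset_hyperplane {v : EuclideanSpace ℝ (Fin n)} {h : ℝ} (hh : 0 < h)
    {B : Set (EuclideanSpace ℝ (Fin n))} (hB : ∀ y ∈ B, ⟪y, v⟫ = h) {z : EuclideanSpace ℝ (Fin n)} :
    z ∈ Set.Ioo (0 : ℝ) 1 • B ↔ ⟪z, v⟫ ∈ Set.Ioo 0 h ∧ z ∈ (⟪z, v⟫ / h) • B := by
  constructor
  · rintro ⟨s, hs, y, hy, rfl⟩
    simp only [real_inner_smul_left, hB y hy]
    refine ⟨⟨mul_pos hs.1 hh, mul_lt_of_lt_one_left hh hs.2⟩, ?_⟩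
    rw [mul_div_cancel_right₀ _ hh.ne']
    exact Set.smul_mem_smul_set hy
  · rintro ⟨hz, y, hy, hyz⟩
    exact ⟨⟪z, v⟫ / h, ⟨div_pos hz.1 hh, (div_lt_one hh).2 hz.2⟩, y, hy, hyz⟩

lemma measurableSet_Ioo_smul_of_subset_hyperplane {v : EuclideanSpace ℝ (Fin n)} {h : ℝ}
    (hh : 0 < h) {B : Set (EuclideanSpace ℝ (Fin n))} (hBm : MeasurableSet B)
    (hB : ∀ y ∈ B, ⟪y, v⟫ = h) : MeasurableSet (Set.Ioo (0 : ℝ) 1 • B) := by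
  have : Set.Ioo (0 : ℝ) 1 • B = (fun z => ⟪z, v⟫) ⁻¹' Set.Ioo 0 h ∩
      (fun z => (⟪z, v⟫ / h)⁻¹ • z) ⁻¹' B := by
    ext z
    rw [mem_Ioo_smul_iff_of_subset_hyperplane hh hB]
    simp only [Set.mem_inter_iff, Set.mem_preimage]
    refine and_congr_right fun hz => ?_
    rw [Set.mem_smul_set_iff_inv_smul_mem₀ (div_pos hz.1 hh).ne']
  rw [this]
  have h1 : Measurable fun z : EuclideanSpace ℝ (Fin n) => ⟪z, v⟫ := by fun_prop
  have h2 : Measurable fun z : EuclideanSpace ℝ (Fin n) => (⟪z, v⟫ / h)⁻¹ • z :=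
    ((h1.div_const h).inv).smul measurable_id
  exact (h1 measurableSet_Ioo).inter (h2 hBm)

/-- The volume of a cone with apex at the origin over a base in a hyperplane. -/
lemma natCast_mul_volume_Ioo_smul (hn : 1 ≤ n) {v : EuclideanSpace ℝ (Fin n)} (hv : ‖v‖ = 1)
    {h : ℝ} (hh : 0 < h) {B : Set (EuclideanSpace ℝ (Fin n))} (hBm : MeasurableSet B)
    (hB : ∀ y ∈ B, ⟪y, v⟫ = h) :
    n * volume (Set.Ioo (0 : ℝ) 1 • B) = ENNReal.ofReal h * μHE[n - 1] B := by
  have hv0 : v ≠ 0 := by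
    rintro rfl
    simp at hv
  have hvol : volume (Set.Ioo (0 : ℝ) 1 • B) = ∫⁻ x : ℝ, (Set.Ioo 0 h).indicator
      (fun x => ENNReal.ofReal ((x / h) ^ (n - 1)) * μHE[n - 1] B) x := by
    -- Fubini along `v`: the slice at height `x ∈ (0, h)` is `(x / h) • B`, whose measure scales by
    -- `(x / h) ^ (n - 1)`.
    rw [← InnerProductSpace.euclideanHausdorffMeasure_eq_volume,
      EuclideanGeometry.euclideanHausdorffMeasure_eq_lintegral (0 : EuclideanSpace ℝ (Fin n)) hv0
        (measurableSet_Ioo_smul_of_subset_hyperplane hh hBm hB), finrank_euclideanSpace_fin]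
    have : ‖v‖ₑ = 1 := by rw [← ofReal_norm, hv, ENNReal.ofReal_one]
    rw [this, one_mul]
    refine lintegral_congr fun x => ?_
    have hslice : ∀ z, z ∈ AffineSubspace.mk' (x • v +ᵥ (0 : EuclideanSpace ℝ (Fin n)))
        (Submodule.span ℝ {v})ᗮ ↔ ⟪z, v⟫ = x := fun z => by
      rw [AffineSubspace.mem_mk', Submodule.mem_orthogonal_singleton_iff_inner_left]
      simp only [vsub_eq_sub, vadd_eq_add, add_zero, inner_sub_left, real_inner_smul_left,
        real_inner_self_eq_norm_sq, hv]
      constructor <;> intro h <;> linarith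
    by_cases hx : x ∈ Set.Ioo 0 h
    · rw [Set.indicator_of_mem hx]
      have hset : (Set.Ioo (0 : ℝ) 1 • B) ∩ AffineSubspace.mk'
          (x • v +ᵥ (0 : EuclideanSpace ℝ (Fin n))) (Submodule.span ℝ {v})ᗮ = (x / h) • B := by
        ext z
        simp only [Set.mem_inter_iff, SetLike.mem_coe, hslice,
          mem_Ioo_smul_iff_of_subset_hyperplane hh hB]
        constructor
        · rintro ⟨⟨-, hz⟩, rfl⟩
          exact hz
        · intro hz
          have hzx : ⟪z, v⟫ = x := by
            obtain ⟨y, hy, rfl⟩ := hz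
            simp only [real_inner_smul_left, hB y hy]
            field_simp
          rw [hzx]
          exact ⟨⟨hx, hz⟩, rfl⟩
      have hpos : 0 < x / h := div_pos hx.1 hh
      rw [hset, Measure.euclideanHausdorffMeasure_smul₀ _ hpos.ne', ENNReal.smul_def, smul_eq_mul,
        ENNReal.ofReal_pow hpos.le, ENNReal.coe_pow]
      congr 2
      rw [← enorm_eq_nnnorm, ← ofReal_norm, Real.norm_of_nonneg hpos.le]
    · rw [Set.indicator_of_notMem hx]
      refine (congrArg _ ?_).trans (measure_empty (μ := μHE[n - 1]))
      ext z
      simp only [Set.mem_inter_iff, SetLike.mem_coe, hslice,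
        mem_Ioo_smul_iff_of_subset_hyperplane hh hB, Set.mem_empty_iff_false, iff_false]
      rintro ⟨⟨hz, -⟩, rfl⟩
      exact hx hz
  rw [hvol, lintegral_indicator measurableSet_Ioo, lintegral_mul_const _ (by fun_prop),
    lintegral_Ioo_div_pow hn hh, ← mul_assoc, ← ENNReal.ofReal_natCast,
    ← ENNReal.ofReal_mul (Nat.cast_nonneg n)]
  congr 2
  have : (n : ℝ) ≠ 0 := by positivity
  field_simp

variable {v : EuclideanSpace ℝ (Fin n)} {h a b : ℝ} {U : Set (UnitSphere n)}

lemma natCast_mul_volume_centralProjection (hn : 1 ≤ n) (hv : ‖v‖ = 1) (hh : 0 < h)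
    (hU : MeasurableSet U) (hUv : ∀ u ∈ U, 0 < ⟪(u : EuclideanSpace ℝ (Fin n)), v⟫) :
    n * volume (Set.Ioo (0 : ℝ) 1 • ((fun u : UnitSphere n =>
      (h / ⟪(u : EuclideanSpace ℝ (Fin n)), v⟫) • (u : EuclideanSpace ℝ (Fin n))) '' U)) =
    ENNReal.ofReal h * μHE[n - 1] ((fun u : UnitSphere n =>
      (h / ⟪(u : EuclideanSpace ℝ (Fin n)), v⟫) • (u : EuclideanSpace ℝ (Fin n))) '' U) := by
  refine natCast_mul_volume_Ioo_smul hn hv hh ?_ ?_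
  -- The image is Borel as an injective continuous image; injectivity holds because the norm of an
  -- image point is the factor `h / (u · v)`.
  · refine hU.image_of_continuousOn_injOn ?_ ?_
    · refine ContinuousOn.smul (ContinuousOn.div continuousOn_const (by fun_prop)
        fun u hu => (hUv u hu).ne') (by fun_prop)
    · intro u hu w hw heq
      have h1 := congrArg (‖·‖) heq
      simp only [norm_smul, norm_eq_of_mem_sphere, mul_one,
        Real.norm_of_nonneg (div_pos hh (hUv u hu)).le,
        Real.norm_of_nonneg (div_pos hh (hUv w hw)).le] at h1
      simp only [h1] at heq
      exact Subtype.ext (smul_right_injective _ (div_pos hh (hUv w hw)).ne' heq)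
  · rintro _ ⟨u, hu, rfl⟩
    simp only [real_inner_smul_left]
    exact div_mul_cancel₀ _ (hUv u hu).ne'

lemma Ioo_smul_subset_smul_Ioo_smul {E : Type*} [AddCommGroup E] [Module ℝ E] {s t : Set E}
    (hb : 0 < b) (hst : ∀ y ∈ s, ∃ c, 0 < c ∧ c ≤ b ∧ ∃ z ∈ t, y = c • z) :
    Set.Ioo (0 : ℝ) 1 • s ⊆ b • (Set.Ioo (0 : ℝ) 1 • t) := by
  rintro _ ⟨r, hr, y, hy, rfl⟩
  obtain ⟨c, hc, hcb, z, hz, rfl⟩ := hst y hy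
  refine ⟨(r * (c / b)) • z, ⟨r * (c / b), ⟨by have := hr.1; positivity, ?_⟩, z, hz, rfl⟩, ?_⟩
  · exact mul_lt_one_of_nonneg_of_lt_one_left hr.1.le hr.2 ((div_le_one hb).2 hcb)
  · simp only [smul_smul]
    congr 1
    field_simp

/-- Both sides are `n` times volumes of cones, and the cone over the projection lies in the
`b`-dilate of the cone over `U`. -/
lemma euclideanHausdorffMeasure_centralProjection_le (hn : 1 ≤ n) (hv : ‖v‖ = 1) (hh : 0 < h)
    (hU : MeasurableSet U) (hb : 0 < b) (hUv : ∀ u ∈ U, 0 < ⟪(u : EuclideanSpace ℝ (Fin n)), v⟫)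
    (hUb : ∀ u ∈ U, h / ⟪(u : EuclideanSpace ℝ (Fin n)), v⟫ ≤ b) :
    ENNReal.ofReal h * μHE[n - 1] ((fun u : UnitSphere n =>
      (h / ⟪(u : EuclideanSpace ℝ (Fin n)), v⟫) • (u : EuclideanSpace ℝ (Fin n))) '' U) ≤
    ENNReal.ofReal (b ^ n) * (volume : Measure (EuclideanSpace ℝ (Fin n))).toSphere U := by
  rw [← natCast_mul_volume_centralProjection hn hv hh hU hUv, Measure.toSphere_apply' _ hU,
    finrank_euclideanSpace_fin, mul_left_comm]
  refine mul_le_mul_right ?_ _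
  have := Measure.addHaar_smul_of_nonneg (volume : Measure (EuclideanSpace ℝ (Fin n))) hb.le
    (Set.Ioo (0 : ℝ) 1 • ((fun u : UnitSphere n => (u : EuclideanSpace ℝ (Fin n))) '' U))
  rw [finrank_euclideanSpace_fin] at this
  refine le_of_le_of_eq (measure_mono (Ioo_smul_subset_smul_Ioo_smul hb ?_)) this
  rintro _ ⟨u, hu, rfl⟩
  exact ⟨_, div_pos hh (hUv u hu), hUb u hu, u, ⟨u, hu, rfl⟩, rfl⟩

lemma le_euclideanHausdorffMeasure_centralProjection (hn : 1 ≤ n) (hv : ‖v‖ = 1) (hh : 0 < h)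
    (hU : MeasurableSet U) (ha : 0 < a) (hUv : ∀ u ∈ U, 0 < ⟪(u : EuclideanSpace ℝ (Fin n)), v⟫)
    (hUa : ∀ u ∈ U, a ≤ h / ⟪(u : EuclideanSpace ℝ (Fin n)), v⟫) :
    (volume : Measure (EuclideanSpace ℝ (Fin n))).toSphere U ≤
    ENNReal.ofReal (a⁻¹ ^ n) * (ENNReal.ofReal h * μHE[n - 1] ((fun u : UnitSphere n =>
      (h / ⟪(u : EuclideanSpace ℝ (Fin n)), v⟫) • (u : EuclideanSpace ℝ (Fin n))) '' U)) := by
  rw [← natCast_mul_volume_centralProjection hn hv hh hU hUv, Measure.toSphere_apply' _ hU,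
    finrank_euclideanSpace_fin, mul_left_comm]
  refine mul_le_mul_right ?_ _
  have := Measure.addHaar_smul_of_nonneg (volume : Measure (EuclideanSpace ℝ (Fin n)))
    (inv_pos.2 ha).le (Set.Ioo (0 : ℝ) 1 • ((fun u : UnitSphere n =>
      (h / ⟪(u : EuclideanSpace ℝ (Fin n)), v⟫) • (u : EuclideanSpace ℝ (Fin n))) '' U))
  rw [finrank_euclideanSpace_fin] at this
  refine le_of_le_of_eq (measure_mono (Ioo_smul_subset_smul_Ioo_smul (inv_pos.2 ha) ?_)) this
  rintro _ ⟨u, hu, rfl⟩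
  have hpos := div_pos hh (hUv u hu)
  refine ⟨_, inv_pos.2 hpos, inv_anti₀ ha (hUa u hu), _, ⟨u, hu, rfl⟩, ?_⟩
  simp only [smul_smul]
  rw [inv_mul_cancel₀ hpos.ne', one_smul]

end Cones

/-! ### Bi-Lipschitz comparison of the boundary with a hyperplane. -/

section LocalComparison

/-- The hypothesis says that on `U` the map `f` factors through `g` by a `k`-Lipschitz map. -/
lemma euclideanHausdorffMeasure_image_le_of_dist_le {X Y Z : Type*} [MetricSpace Y]
    [MeasurableSpace Y] [BorelSpace Y] [MetricSpace Z] [MeasurableSpace Z] [BorelSpace Z]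
    {f : X → Y} {g : X → Z} {U : Set X} {k : ℝ} (hk : 0 ≤ k)
    (hfg : ∀ u ∈ U, ∀ w ∈ U, dist (f u) (f w) ≤ k * dist (g u) (g w)) (d : ℕ) :
    μHE[d] (f '' U) ≤ ENNReal.ofReal (k ^ d) * μHE[d] (g '' U) := by
  rcases U.eq_empty_or_nonempty with rfl | ⟨x, hx⟩
  · simp
  have : Nonempty X := ⟨x⟩
  have hinv : ∀ z ∈ g '' U, Function.invFunOn g U z ∈ U ∧ g (Function.invFunOn g U z) = z :=
    fun z hz => ⟨Function.invFunOn_mem hz, Function.invFunOn_eq hz⟩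
  have hlip : LipschitzOnWith k.toNNReal (f ∘ Function.invFunOn g U) (g '' U) := by
    refine LipschitzOnWith.of_dist_le_mul fun z hz z' hz' => ?_
    have := hfg _ (hinv z hz).1 _ (hinv z' hz').1
    rw [(hinv z hz).2, (hinv z' hz').2] at this
    rwa [Real.coe_toNNReal _ hk]
  have himage : (f ∘ Function.invFunOn g U) '' (g '' U) = f '' U := by
    rw [Set.image_image]
    refine Set.image_congr fun u hu => ?_
    have h1 := hinv (g u) ⟨u, hu, rfl⟩
    have h2 := hfg _ h1.1 u hu
    rw [h1.2, dist_self, mul_zero] at h2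
    exact dist_le_zero.1 h2
  have h := hlip.hausdorffMeasure_image_le (d := d) (Nat.cast_nonneg d)
  rw [himage, ENNReal.rpow_natCast] at h
  simp only [Measure.euclideanHausdorffMeasure_def, Measure.smul_apply, ENNReal.smul_def, smul_eq_mul]
  rw [mul_left_comm, ENNReal.ofReal_pow hk]
  exact mul_le_mul_right h _

/-- The difference of the projections is `c • ((x - y) - e)`, where `c ∈ [k⁻¹, k]` and the error `e`
has norm at most `(1 - k⁻¹) * ‖x - y‖` because `x - y` is nearly orthogonal to `v`. Each of the two
effects costs one factor `k`. -/
lemma norm_centralProjection_sub_le {E : Type*} [NormedAddCommGroup E] [InnerProductSpace ℝ E]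
    {x y v : E} {h k η M : ℝ} (hk : 1 < k) (hx : 0 < ⟪x, v⟫) (hy : 0 < ⟪y, v⟫) (hη : 0 ≤ η)
    (hlo : k⁻¹ ≤ h / ⟪x, v⟫) (hhi : h / ⟪x, v⟫ ≤ k) (hxy : |⟪x - y, v⟫| ≤ η * ‖x - y‖)
    (hM : ‖y‖ ≤ M * ⟪y, v⟫) (hηM : η * M ≤ 1 - k⁻¹) :
    ‖(h / ⟪x, v⟫) • x - (h / ⟪y, v⟫) • y‖ ≤ k ^ 2 * ‖x - y‖ ∧
      ‖x - y‖ ≤ k ^ 2 * ‖(h / ⟪x, v⟫) • x - (h / ⟪y, v⟫) • y‖ := by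
  have hk0 : 0 < k := one_pos.trans hk
  have hk' : 0 < k⁻¹ := inv_pos.2 hk0
  set c := h / ⟪x, v⟫ with hc
  have hc0 : 0 < c := hk'.trans_le hlo
  set e := (⟪x - y, v⟫ / ⟪y, v⟫) • y with he
  have hdiff : c • x - (h / ⟪y, v⟫) • y = c • ((x - y) - e) := by
    rw [he, inner_sub_left, sub_div, div_self hy.ne', sub_smul, one_smul, sub_sub,
      add_sub_cancel, smul_sub, smul_smul]
    congr 2
    rw [hc]
    field_simp
  have hen : ‖e‖ ≤ (1 - k⁻¹) * ‖x - y‖ := by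
    rw [he, norm_smul, norm_div, Real.norm_of_nonneg hy.le, Real.norm_eq_abs, div_mul_eq_mul_div,
      div_le_iff₀ hy]
    calc |⟪x - y, v⟫| * ‖y‖ ≤ (η * ‖x - y‖) * (M * ⟪y, v⟫) :=
          mul_le_mul hxy hM (norm_nonneg _) (by positivity)
      _ = (η * M) * (‖x - y‖ * ⟪y, v⟫) := by ring
      _ ≤ (1 - k⁻¹) * (‖x - y‖ * ⟪y, v⟫) := mul_le_mul_of_nonneg_right hηM (by positivity)
      _ = _ := by ring
  rw [hdiff, norm_smul, Real.norm_of_nonneg hc0.le]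
  -- Equivalent to `(k - 1) ^ 2 / k ≥ 0`; it bounds the factor `1 + (1 - k⁻¹)` by `k`.
  have h2k : 2 - k⁻¹ ≤ k := by
    have : (k - 1) ^ 2 * k⁻¹ = k - 2 + k⁻¹ := by field_simp; ring
    nlinarith [mul_nonneg (sq_nonneg (k - 1)) hk'.le]
  have hn := norm_nonneg (x - y)
  constructor
  · have h1 : ‖x - y - e‖ ≤ k * ‖x - y‖ := by
      have := norm_sub_le (x - y) e
      nlinarith
    calc c * ‖x - y - e‖ ≤ k * (k * ‖x - y‖) := mul_le_mul hhi h1 (norm_nonneg _) hk0.le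
      _ = _ := by ring
  · have h1 : k⁻¹ * ‖x - y‖ ≤ ‖x - y - e‖ := by
      have := norm_sub_norm_le (x - y) e
      linarith
    have h2 : k⁻¹ * (k⁻¹ * ‖x - y‖) ≤ c * ‖x - y - e‖ :=
      mul_le_mul hlo h1 (by positivity) hc0.le
    have h3 := mul_le_mul_of_nonneg_left h2 (sq_nonneg k)
    have h4 : k ^ 2 * (k⁻¹ * (k⁻¹ * ‖x - y‖)) = ‖x - y‖ := by field_simp
    linarith

variable {n : ℕ} {K : ConvexBody (EuclideanSpace ℝ (Fin n))}

/-- Monotonicity of normals gives `(x - y) · w ≥ 0` and `(x - y) · w' ≤ 0`; replacing `w` and `w'`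
by `v` costs `η * ‖x - y‖`. Convexity thus supplies flatness without any smoothness. -/
lemma abs_inner_sub_le_of_isOuterUnitNormal {x y v : EuclideanSpace ℝ (Fin n)}
    {w w' : UnitSphere n} {η : ℝ} (hx : IsOuterUnitNormal K x w) (hy : IsOuterUnitNormal K y w')
    (hw : ‖(w : EuclideanSpace ℝ (Fin n)) - v‖ ≤ η)
    (hw' : ‖(w' : EuclideanSpace ℝ (Fin n)) - v‖ ≤ η) :
    |⟪x - y, v⟫| ≤ η * ‖x - y‖ := by
  have h1 := inner_le_supportFunction K hy.1 w
  rw [← hx.2] at h1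
  have h2 := inner_le_supportFunction K hx.1 w'
  rw [← hy.2] at h2
  have h3 := abs_le.1 (abs_real_inner_le_norm (x - y) ((w : EuclideanSpace ℝ (Fin n)) - v))
  have h4 := abs_le.1 (abs_real_inner_le_norm (x - y) ((w' : EuclideanSpace ℝ (Fin n)) - v))
  have h5 := mul_le_mul_of_nonneg_left hw (norm_nonneg (x - y))
  have h6 := mul_le_mul_of_nonneg_left hw' (norm_nonneg (x - y))
  rw [inner_sub_right, inner_sub_left x y, inner_sub_left x y] at h3 h4
  rw [abs_le, inner_sub_left]
  constructor <;> linarith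

/-- The conditions, all open in `(u, w)`, under which the boundary of `K` at `boundaryPoint K u`
with normal `w` is within the factor `k` of the hyperplane `⟪·, v⟫ = h` near a point of norm `l`. -/
structure IsNearHyperplane (K : ConvexBody (EuclideanSpace ℝ (Fin n))) (v : UnitSphere n)
    (h l M k : ℝ) (u w : UnitSphere n) : Prop where
  inner_pos : 0 < ⟪boundaryPoint K u, (v : EuclideanSpace ℝ (Fin n))⟫
  height_lower : k⁻¹ < h / ⟪boundaryPoint K u, (v : EuclideanSpace ℝ (Fin n))⟫
  height_upper : h / ⟪boundaryPoint K u, (v : EuclideanSpace ℝ (Fin n))⟫ < k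
  norm_lower : l * k⁻¹ < ‖boundaryPoint K u‖
  norm_upper : ‖boundaryPoint K u‖ < l * k
  norm_lt : ‖boundaryPoint K u‖ < M * ⟪boundaryPoint K u, (v : EuclideanSpace ℝ (Fin n))⟫
  normal_near : ‖(w : EuclideanSpace ℝ (Fin n)) - v‖ < (1 - k⁻¹) / M
  density_lower : l ^ n / h * k⁻¹ <
    ‖boundaryPoint K u‖ ^ n / ⟪boundaryPoint K u, (w : EuclideanSpace ℝ (Fin n))⟫
  density_upper : ‖boundaryPoint K u‖ ^ n / ⟪boundaryPoint K u, (w : EuclideanSpace ℝ (Fin n))⟫ <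
    l ^ n / h * k

/-- Every condition is a strict inequality between functions continuous at `(u, v)` and holds there.
The choice of `M` gives `M * h = l + h > l`. -/
lemma eventually_isNearHyperplane
    (hK : (0 : EuclideanSpace ℝ (Fin n)) ∈ interior (K : Set (EuclideanSpace ℝ (Fin n))))
    {u v : UnitSphere n} (hv : IsOuterUnitNormal K (boundaryPoint K u) v) {k : ℝ} (hk : 1 < k) :
    ∀ᶠ p : UnitSphere n × UnitSphere n in 𝓝 (u, v),
      IsNearHyperplane K v (supportFunction K v) ‖boundaryPoint K u‖
        (‖boundaryPoint K u‖ / supportFunction K v + 1) k p.1 p.2 := by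
  set h := supportFunction K v with hh
  set l := ‖boundaryPoint K u‖ with hl
  have hh0 : 0 < h := supportFunction_sphere_pos hK v
  have hl0 : 0 < l := norm_boundaryPoint_pos hK u
  have hk0 : 0 < k := one_pos.trans hk
  have hk1 : k⁻¹ < 1 := inv_lt_one_of_one_lt₀ hk
  have hin : ⟪boundaryPoint K u, (v : EuclideanSpace ℝ (Fin n))⟫ = h := hv.2
  have hb : Continuous fun p : UnitSphere n × UnitSphere n => boundaryPoint K p.1 :=
    (continuous_boundaryPoint hK).comp continuous_fst
  have hn : Continuous fun p : UnitSphere n × UnitSphere n => ‖boundaryPoint K p.1‖ := hb.norm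
  have hi : Continuous fun p : UnitSphere n × UnitSphere n =>
      ⟪boundaryPoint K p.1, (v : EuclideanSpace ℝ (Fin n))⟫ := hb.inner continuous_const
  have hi' : Continuous fun p : UnitSphere n × UnitSphere n =>
      ⟪boundaryPoint K p.1, (p.2 : EuclideanSpace ℝ (Fin n))⟫ :=
    hb.inner (continuous_subtype_val.comp continuous_snd)
  have hdiv : ContinuousAt (fun p : UnitSphere n × UnitSphere n =>
      h / ⟪boundaryPoint K p.1, (v : EuclideanSpace ℝ (Fin n))⟫) (u, v) :=
    continuousAt_const.div hi.continuousAt (by simp only [hin]; exact hh0.ne')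
  have hdens : ContinuousAt (fun p : UnitSphere n × UnitSphere n =>
      ‖boundaryPoint K p.1‖ ^ n / ⟪boundaryPoint K p.1, (p.2 : EuclideanSpace ℝ (Fin n))⟫) (u, v) :=
    (hn.pow n).continuousAt.div hi'.continuousAt (by simp only [hin]; exact hh0.ne')
  have hw : Continuous fun p : UnitSphere n × UnitSphere n =>
      ‖(p.2 : EuclideanSpace ℝ (Fin n)) - v‖ := by fun_prop
  have hpos : 0 < l ^ n / h := by positivity
  have hM : 0 < l / h + 1 := by positivity
  have h1 : ∀ᶠ p : UnitSphere n × UnitSphere n in 𝓝 (u, v),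
      0 < ⟪boundaryPoint K p.1, (v : EuclideanSpace ℝ (Fin n))⟫ :=
    continuousAt_const.eventually_lt hi.continuousAt (hin.symm ▸ hh0)
  have h2 : ∀ᶠ p : UnitSphere n × UnitSphere n in 𝓝 (u, v),
      k⁻¹ < h / ⟪boundaryPoint K p.1, (v : EuclideanSpace ℝ (Fin n))⟫ :=
    continuousAt_const.eventually_lt hdiv (by simpa only [hin, div_self hh0.ne'] using hk1)
  have h3 : ∀ᶠ p : UnitSphere n × UnitSphere n in 𝓝 (u, v),
      h / ⟪boundaryPoint K p.1, (v : EuclideanSpace ℝ (Fin n))⟫ < k :=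
    hdiv.eventually_lt continuousAt_const (by simpa only [hin, div_self hh0.ne'] using hk)
  have h4 : ∀ᶠ p : UnitSphere n × UnitSphere n in 𝓝 (u, v),
      l * k⁻¹ < ‖boundaryPoint K p.1‖ :=
    continuousAt_const.eventually_lt hn.continuousAt (mul_lt_of_lt_one_right hl0 hk1)
  have h5 : ∀ᶠ p : UnitSphere n × UnitSphere n in 𝓝 (u, v),
      ‖boundaryPoint K p.1‖ < l * k :=
    hn.continuousAt.eventually_lt continuousAt_const (lt_mul_of_one_lt_right hl0 hk)
  have h6 : ∀ᶠ p : UnitSphere n × UnitSphere n in 𝓝 (u, v),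
      ‖boundaryPoint K p.1‖ < (l / h + 1) * ⟪boundaryPoint K p.1, (v : EuclideanSpace ℝ (Fin n))⟫ :=
    hn.continuousAt.eventually_lt (hi.const_mul (l / h + 1)).continuousAt (by
      simp only [hin, add_mul, div_mul_cancel₀ _ hh0.ne', one_mul]
      exact lt_add_of_pos_right _ hh0)
  have h7 : ∀ᶠ p : UnitSphere n × UnitSphere n in 𝓝 (u, v),
      ‖(p.2 : EuclideanSpace ℝ (Fin n)) - v‖ < (1 - k⁻¹) / (l / h + 1) :=
    hw.continuousAt.eventually_lt continuousAt_const (by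
      simp only [sub_self, norm_zero]
      exact div_pos (sub_pos.2 hk1) hM)
  have h8 : ∀ᶠ p : UnitSphere n × UnitSphere n in 𝓝 (u, v),
      l ^ n / h * k⁻¹ <
      ‖boundaryPoint K p.1‖ ^ n / ⟪boundaryPoint K p.1, (p.2 : EuclideanSpace ℝ (Fin n))⟫ :=
    continuousAt_const.eventually_lt hdens (by
      simp only [hin]
      exact mul_lt_of_lt_one_right hpos hk1)
  have h9 : ∀ᶠ p : UnitSphere n × UnitSphere n in 𝓝 (u, v),
      ‖boundaryPoint K p.1‖ ^ n / ⟪boundaryPoint K p.1, (p.2 : EuclideanSpace ℝ (Fin n))⟫ <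
      l ^ n / h * k :=
    hdens.eventually_lt continuousAt_const (by
      simp only [hin]
      exact lt_mul_of_one_lt_right hpos hk)
  filter_upwards [h1, h2, h3, h4, h5, h6, h7, h8, h9] with p h1 h2 h3 h4 h5 h6 h7 h8 h9
  exact ⟨h1, h2, h3, h4, h5, h6, h7, h8, h9⟩

variable {v : UnitSphere n} {h l M k : ℝ} {U : Set (UnitSphere n)}

lemma dist_centralProjection_le_of_isNearHyperplane
    (hK : (0 : EuclideanSpace ℝ (Fin n)) ∈ interior (K : Set (EuclideanSpace ℝ (Fin n))))
    (hk : 1 < k) (hM : 0 < M)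
    (hU : ∀ u ∈ U, ∃ w, IsOuterUnitNormal K (boundaryPoint K u) w ∧ IsNearHyperplane K v h l M k u w)
    {u u' : UnitSphere n} (hu : u ∈ U) (hu' : u' ∈ U) :
    dist ((h / ⟪(u : EuclideanSpace ℝ (Fin n)), (v : EuclideanSpace ℝ (Fin n))⟫) •
        (u : EuclideanSpace ℝ (Fin n)))
      ((h / ⟪(u' : EuclideanSpace ℝ (Fin n)), (v : EuclideanSpace ℝ (Fin n))⟫) •
        (u' : EuclideanSpace ℝ (Fin n))) ≤ k ^ 2 * dist (boundaryPoint K u) (boundaryPoint K u') ∧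
    dist (boundaryPoint K u) (boundaryPoint K u') ≤ k ^ 2 *
      dist ((h / ⟪(u : EuclideanSpace ℝ (Fin n)), (v : EuclideanSpace ℝ (Fin n))⟫) •
        (u : EuclideanSpace ℝ (Fin n)))
      ((h / ⟪(u' : EuclideanSpace ℝ (Fin n)), (v : EuclideanSpace ℝ (Fin n))⟫) •
        (u' : EuclideanSpace ℝ (Fin n))) := by
  have hproj : ∀ u : UnitSphere n,
      (h / ⟪boundaryPoint K u, (v : EuclideanSpace ℝ (Fin n))⟫) • boundaryPoint K u =
      (h / ⟪(u : EuclideanSpace ℝ (Fin n)), (v : EuclideanSpace ℝ (Fin n))⟫) •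
        (u : EuclideanSpace ℝ (Fin n)) := fun u => by
    have hpos := norm_boundaryPoint_pos hK u
    rw [boundaryPoint_eq_norm_smul hK u, real_inner_smul_left, smul_smul]
    congr 1
    rw [mul_comm, mul_div, mul_div_mul_left _ _ hpos.ne']
  obtain ⟨w, hw, hnear⟩ := hU u hu
  obtain ⟨w', hw', hnear'⟩ := hU u' hu'
  have hk1 : k⁻¹ < 1 := inv_lt_one_of_one_lt₀ hk
  simp only [dist_eq_norm, ← hproj]
  exact norm_centralProjection_sub_le hk hnear.inner_pos hnear'.inner_pos
    (div_nonneg (sub_nonneg.2 hk1.le) hM.le) hnear.height_lower.le hnear.height_upper.le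
    (abs_inner_sub_le_of_isOuterUnitNormal hw hw' hnear.normal_near.le hnear'.normal_near.le)
    hnear'.norm_lt.le (div_mul_cancel₀ _ hM.ne').le

end LocalComparison

/-! ### Surface measure pulled back to the sphere. -/

section SurfaceMeasure

lemma le_ofReal_mul_trans {X Y Z : ℝ≥0∞} {a b : ℝ} (ha : 0 ≤ a) (hXY : X ≤ ENNReal.ofReal a * Y)
    (hYZ : Y ≤ ENNReal.ofReal b * Z) : X ≤ ENNReal.ofReal (a * b) * Z := by
  rw [ENNReal.ofReal_mul ha, mul_assoc]
  exact hXY.trans (mul_le_mul_right hYZ _)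

lemma le_ofReal_inv_mul {X Y : ℝ≥0∞} {a : ℝ} (ha : 0 < a) (h : ENNReal.ofReal a * X ≤ Y) :
    X ≤ ENNReal.ofReal a⁻¹ * Y := by
  refine le_trans (le_of_eq ?_) (mul_le_mul_right h _)
  rw [← mul_assoc, ← ENNReal.ofReal_mul (inv_pos.2 ha).le, inv_mul_cancel₀ ha.ne',
    ENNReal.ofReal_one, one_mul]

variable {n : ℕ} {K : ConvexBody (EuclideanSpace ℝ (Fin n))}

section Local

variable {v : UnitSphere n} {h l M k : ℝ} {U : Set (UnitSphere n)}

/-- The density bounds concern the normal `w` provided by `hU`; at points of differentiability it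
coincides with `gaussMap K u`. -/
lemma boundaryJacobian_mem_Icc_of_isNearHyperplane
    (hK : (0 : EuclideanSpace ℝ (Fin n)) ∈ interior (K : Set (EuclideanSpace ℝ (Fin n))))
    (hU : ∀ u ∈ U, ∃ w, IsOuterUnitNormal K (boundaryPoint K u) w ∧ IsNearHyperplane K v h l M k u w) :
    ∀ᵐ u ∂(volume : Measure (EuclideanSpace ℝ (Fin n))).toSphere, u ∈ U →
      boundaryJacobian K u ∈ Set.Icc (l ^ n / h * k⁻¹) (l ^ n / h * k) := by
  filter_upwards [ae_differentiableAt_gauge hK] with u hu huU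
  obtain ⟨w, hw, hnear⟩ := hU u huU
  rw [boundaryJacobian, ← eq_gaussMap_of_isOuterUnitNormal hK hu hw]
  exact ⟨hnear.density_lower.le, hnear.density_upper.le⟩

lemma div_inner_mem_Icc_of_isNearHyperplane
    (hK : (0 : EuclideanSpace ℝ (Fin n)) ∈ interior (K : Set (EuclideanSpace ℝ (Fin n))))
    (hk : 1 < k) (hl : 0 < l) {u w : UnitSphere n} (hnear : IsNearHyperplane K v h l M k u w) :
    0 < ⟪(u : EuclideanSpace ℝ (Fin n)), (v : EuclideanSpace ℝ (Fin n))⟫ ∧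
    h / ⟪(u : EuclideanSpace ℝ (Fin n)), (v : EuclideanSpace ℝ (Fin n))⟫ ∈
      Set.Icc (l * (k ^ 2)⁻¹) (l * k ^ 2) := by
  have hpos := norm_boundaryPoint_pos hK u
  have hk0 : 0 < k := one_pos.trans hk
  have hk' : 0 < k⁻¹ := inv_pos.2 hk0
  have hi : ⟪boundaryPoint K u, (v : EuclideanSpace ℝ (Fin n))⟫ = ‖boundaryPoint K u‖ *
      ⟪(u : EuclideanSpace ℝ (Fin n)), (v : EuclideanSpace ℝ (Fin n))⟫ := by
    conv_lhs => rw [boundaryPoint_eq_norm_smul hK u, real_inner_smul_left]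
  have h0 := hnear.inner_pos
  rw [hi] at h0
  have heq : h / ⟪(u : EuclideanSpace ℝ (Fin n)), (v : EuclideanSpace ℝ (Fin n))⟫ =
      ‖boundaryPoint K u‖ * (h / ⟪boundaryPoint K u, (v : EuclideanSpace ℝ (Fin n))⟫) := by
    rw [hi, mul_div, mul_div_mul_left _ _ hpos.ne']
  refine ⟨(mul_pos_iff_of_pos_left hpos).1 h0, ?_, ?_⟩
  · rw [heq, show l * (k ^ 2)⁻¹ = l * k⁻¹ * k⁻¹ by rw [sq, mul_inv, mul_assoc]]
    exact mul_le_mul hnear.norm_lower.le hnear.height_lower.le hk'.le hpos.le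
  · rw [heq, show l * k ^ 2 = l * k * k by ring]
    exact mul_le_mul hnear.norm_upper.le hnear.height_upper.le
      (hk'.le.trans hnear.height_lower.le) (by positivity)

/-- Three comparisons are chained: density with the constant `l ^ n / h`, sphere with hyperplane,
hyperplane with `∂K`. They cost `k`, `(k ^ 2) ^ n` and `(k ^ 2) ^ (n - 1)`, and `l ^ n / h` cancels.
The reverse inequality below runs the chain backwards. -/
lemma withDensity_boundaryJacobian_le_of_isNearHyperplane (hn : 1 ≤ n)
    (hK : (0 : EuclideanSpace ℝ (Fin n)) ∈ interior (K : Set (EuclideanSpace ℝ (Fin n))))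
    (hk : 1 < k) (hh : 0 < h) (hl : 0 < l) (hM : 0 < M) (hUm : MeasurableSet U)
    (hU : ∀ u ∈ U, ∃ w, IsOuterUnitNormal K (boundaryPoint K u) w ∧ IsNearHyperplane K v h l M k u w) :
    (volume : Measure (EuclideanSpace ℝ (Fin n))).toSphere.withDensity
        (fun u => ENNReal.ofReal (boundaryJacobian K u)) U ≤
      ENNReal.ofReal (k * (k ^ 2) ^ n * (k ^ 2) ^ (n - 1)) * μHE[n - 1] (boundaryPoint K '' U) := by
  have hk0 : 0 < k := one_pos.trans hk
  have hA : (volume : Measure (EuclideanSpace ℝ (Fin n))).toSphere.withDensity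
        (fun u => ENNReal.ofReal (boundaryJacobian K u)) U ≤ ENNReal.ofReal (l ^ n / h * k) *
      (volume : Measure (EuclideanSpace ℝ (Fin n))).toSphere U := by
    rw [withDensity_apply _ hUm, ← setLIntegral_const]
    refine setLIntegral_mono_ae measurable_const.aemeasurable ?_
    filter_upwards [boundaryJacobian_mem_Icc_of_isNearHyperplane hK hU] with u hu huU
    exact ENNReal.ofReal_le_ofReal (hu huU).2
  have hin : ∀ u ∈ U, 0 < ⟪(u : EuclideanSpace ℝ (Fin n)), (v : EuclideanSpace ℝ (Fin n))⟫ ∧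
    h / ⟪(u : EuclideanSpace ℝ (Fin n)), (v : EuclideanSpace ℝ (Fin n))⟫ ∈
      Set.Icc (l * (k ^ 2)⁻¹) (l * k ^ 2) := fun u hu => by
    obtain ⟨w, -, hnear⟩ := hU u hu
    exact div_inner_mem_Icc_of_isNearHyperplane hK hk hl hnear
  have hB := le_euclideanHausdorffMeasure_centralProjection hn (norm_eq_of_mem_sphere v) hh hUm
    (a := l * (k ^ 2)⁻¹) (by positivity) (fun u hu => (hin u hu).1) (fun u hu => (hin u hu).2.1)
  have hC := euclideanHausdorffMeasure_image_le_of_dist_le (k := k ^ 2) (by positivity)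
    (fun u hu u' hu' => (dist_centralProjection_le_of_isNearHyperplane hK hk hM hU hu hu').1) (n - 1)
  have := le_ofReal_mul_trans (by positivity) (le_ofReal_mul_trans (by positivity)
    (le_ofReal_mul_trans (by positivity) hA hB) le_rfl) hC
  refine this.trans (le_of_eq ?_)
  congr 2
  rw [mul_inv, inv_inv, mul_pow, inv_pow]
  field_simp

lemma euclideanHausdorffMeasure_le_of_isNearHyperplane (hn : 1 ≤ n)
    (hK : (0 : EuclideanSpace ℝ (Fin n)) ∈ interior (K : Set (EuclideanSpace ℝ (Fin n))))
    (hk : 1 < k) (hh : 0 < h) (hl : 0 < l) (hM : 0 < M) (hUm : MeasurableSet U)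
    (hU : ∀ u ∈ U, ∃ w, IsOuterUnitNormal K (boundaryPoint K u) w ∧ IsNearHyperplane K v h l M k u w) :
    μHE[n - 1] (boundaryPoint K '' U) ≤ ENNReal.ofReal (k * (k ^ 2) ^ n * (k ^ 2) ^ (n - 1)) *
      (volume : Measure (EuclideanSpace ℝ (Fin n))).toSphere.withDensity
        (fun u => ENNReal.ofReal (boundaryJacobian K u)) U := by
  have hk0 : 0 < k := one_pos.trans hk
  have hA : ENNReal.ofReal (l ^ n / h * k⁻¹) *
      (volume : Measure (EuclideanSpace ℝ (Fin n))).toSphere U ≤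
      (volume : Measure (EuclideanSpace ℝ (Fin n))).toSphere.withDensity
        (fun u => ENNReal.ofReal (boundaryJacobian K u)) U := by
    rw [withDensity_apply _ hUm, ← setLIntegral_const]
    refine setLIntegral_mono_ae (measurable_boundaryJacobian hK).ennreal_ofReal.aemeasurable ?_
    filter_upwards [boundaryJacobian_mem_Icc_of_isNearHyperplane hK hU] with u hu huU
    exact ENNReal.ofReal_le_ofReal (hu huU).1
  have hin : ∀ u ∈ U, 0 < ⟪(u : EuclideanSpace ℝ (Fin n)), (v : EuclideanSpace ℝ (Fin n))⟫ ∧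
    h / ⟪(u : EuclideanSpace ℝ (Fin n)), (v : EuclideanSpace ℝ (Fin n))⟫ ∈
      Set.Icc (l * (k ^ 2)⁻¹) (l * k ^ 2) := fun u hu => by
    obtain ⟨w, -, hnear⟩ := hU u hu
    exact div_inner_mem_Icc_of_isNearHyperplane hK hk hl hnear
  have hB := euclideanHausdorffMeasure_centralProjection_le hn (norm_eq_of_mem_sphere v) hh hUm
    (b := l * k ^ 2) (by positivity) (fun u hu => (hin u hu).1) (fun u hu => (hin u hu).2.2)
  have hC := euclideanHausdorffMeasure_image_le_of_dist_le (k := k ^ 2) (by positivity)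
    (fun u hu u' hu' => (dist_centralProjection_le_of_isNearHyperplane hK hk hM hU hu hu').2) (n - 1)
  have := le_ofReal_mul_trans (by positivity) (le_ofReal_mul_trans (by positivity)
    (le_ofReal_mul_trans (by positivity) hC (le_ofReal_inv_mul hh le_rfl)) hB)
    (le_ofReal_inv_mul (by positivity) hA)
  refine this.trans (le_of_eq ?_)
  congr 2
  rw [mul_pow]
  field_simp

end Local

lemma isClosed_setOf_isOuterUnitNormal
    (hK : (0 : EuclideanSpace ℝ (Fin n)) ∈ interior (K : Set (EuclideanSpace ℝ (Fin n)))) :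
    IsClosed {p : UnitSphere n × UnitSphere n | IsOuterUnitNormal K (boundaryPoint K p.1) p.2} := by
  have hb : Continuous fun p : UnitSphere n × UnitSphere n => boundaryPoint K p.1 :=
    (continuous_boundaryPoint hK).comp continuous_fst
  have hs : Continuous fun p : UnitSphere n × UnitSphere n => supportFunction K p.2 :=
    (continuous_supportFunction K).comp (continuous_subtype_val.comp continuous_snd)
  exact (K.isClosed.preimage hb).inter
    (isClosed_eq (hb.inner (continuous_subtype_val.comp continuous_snd)) hs)

/-- The pieces may overlap, so they are peeled off one at a time. -/
lemma measure_le_mul_of_finset_cover {X ι : Type*} [MeasurableSpace X] {μ ν : Measure X} {κ : ℝ≥0∞}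
    {P : ι → Set X} (hP : ∀ i, MeasurableSet (P i)) {t : Finset ι}
    (hle : ∀ i ∈ t, ∀ U ⊆ P i, MeasurableSet U → μ U ≤ κ * ν U) {U : Set X} (hU : MeasurableSet U)
    (hsub : U ⊆ ⋃ i ∈ t, P i) : μ U ≤ κ * ν U := by
  classical
  induction t using Finset.induction_on generalizing U with
  | empty =>
    have : U = ∅ := by simpa using hsub
    simp [this]
  | insert i t _ ih =>
    rw [← measure_inter_add_sdiff U (hP i), ← measure_inter_add_sdiff (μ := ν) U (hP i), mul_add]
    refine add_le_add (hle i (Finset.mem_insert_self i t) _ Set.inter_subset_right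
      (hU.inter (hP i))) (ih (fun j hj => hle j (Finset.mem_insert_of_mem hj))
      (hU.diff (hP i)) ?_)
    rintro x ⟨hx, hxi⟩
    have := hsub hx
    rw [Finset.set_biUnion_insert] at this
    exact this.resolve_left hxi

/-- Compactness is used on the graph of pairs (direction, normal) rather than on the sphere: normals
at a corner are far apart, so no neighbourhood in `u` alone makes all of them close to one `v`. -/
lemma exists_finset_cover_isNearHyperplane
    (hK : (0 : EuclideanSpace ℝ (Fin n)) ∈ interior (K : Set (EuclideanSpace ℝ (Fin n))))
    {k : ℝ} (hk : 1 < k) :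
    ∃ (P : UnitSphere n × UnitSphere n → Set (UnitSphere n)) (t : Finset (UnitSphere n × UnitSphere n)),
      (∀ p, MeasurableSet (P p)) ∧ (⋃ p ∈ t, P p) = Set.univ ∧
      ∀ p ∈ t, ∃ h l M : ℝ, 0 < h ∧ 0 < l ∧ 0 < M ∧ ∀ u ∈ P p, ∃ w,
        IsOuterUnitNormal K (boundaryPoint K u) w ∧ IsNearHyperplane K p.2 h l M k u w := by
  have hG := isClosed_setOf_isOuterUnitNormal hK
  have hchoose : ∀ p : UnitSphere n × UnitSphere n, ∃ V ∈ 𝓝 p, IsClosed V ∧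
      (IsOuterUnitNormal K (boundaryPoint K p.1) p.2 → ∀ q ∈ V,
        IsNearHyperplane K p.2 (supportFunction K p.2) ‖boundaryPoint K p.1‖
        (‖boundaryPoint K p.1‖ / supportFunction K p.2 + 1) k q.1 q.2) := by
    intro p
    by_cases hp : IsOuterUnitNormal K (boundaryPoint K p.1) p.2
    · obtain ⟨V, hV, hVc, hVs⟩ := exists_mem_nhds_isClosed_subset (eventually_isNearHyperplane hK hp hk)
      exact ⟨V, hV, hVc, fun _ q hq => hVs hq⟩
    -- Pairs outside the graph never serve as centres of the finite cover, so any closed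
    -- neighbourhood will do.
    · exact ⟨Set.univ, univ_mem, isClosed_univ, fun h => absurd h hp⟩
  choose V hV hVc hVnear using hchoose
  obtain ⟨t, htG, ht⟩ := hG.isCompact.elim_nhds_subcover V fun p _ => hV p
  refine ⟨fun p => Prod.fst '' ({p : UnitSphere n × UnitSphere n |
    IsOuterUnitNormal K (boundaryPoint K p.1) p.2} ∩ V p), t, fun p => ?_, ?_, fun p hp => ?_⟩
  · exact ((hG.inter (hVc p)).isCompact.image continuous_fst).isClosed.measurableSet
  · refine Set.eq_univ_of_forall fun u => ?_
    have : Nonempty (UnitSphere n) := ⟨u⟩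
    obtain ⟨w, hw⟩ := exists_isOuterUnitNormal (boundaryPoint_mem_frontier hK u)
    obtain ⟨p, hpt, hp⟩ := Set.mem_iUnion₂.1 (ht (show (u, w) ∈ _ from hw))
    exact Set.mem_iUnion₂.2 ⟨p, hpt, (u, w), ⟨hw, hp⟩, rfl⟩
  · have h0 := supportFunction_sphere_pos hK p.2
    have hl0 := norm_boundaryPoint_pos hK p.1
    refine ⟨supportFunction K p.2, ‖boundaryPoint K p.1‖,
      ‖boundaryPoint K p.1‖ / supportFunction K p.2 + 1, h0, hl0, by positivity, ?_⟩
    rintro _ ⟨q, ⟨hq, hqV⟩, rfl⟩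
    exact ⟨q.2, hq, hVnear p (htG p hp) q hqV⟩

/-- The surface measure of `∂K`, pulled back to the sphere along `boundaryPoint K`, has density
`boundaryJacobian K` with respect to the spherical measure. -/
lemma comap_boundaryPoint_euclideanHausdorffMeasure (hn : 1 ≤ n)
    (hK : (0 : EuclideanSpace ℝ (Fin n)) ∈ interior (K : Set (EuclideanSpace ℝ (Fin n)))) :
    (μHE[n - 1] : Measure (EuclideanSpace ℝ (Fin n))).comap (boundaryPoint K) =
      (volume : Measure (EuclideanSpace ℝ (Fin n))).toSphere.withDensity
        (fun u => ENNReal.ofReal (boundaryJacobian K u)) := by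
  set ν := (volume : Measure (EuclideanSpace ℝ (Fin n))).toSphere.withDensity
        (fun u => ENNReal.ofReal (boundaryJacobian K u)) with hν
  set μ := (μHE[n - 1] : Measure (EuclideanSpace ℝ (Fin n))).comap (boundaryPoint K) with hμ
  have hμapply : ∀ U, μ U = μHE[n - 1] (boundaryPoint K '' U) := fun U =>
    (measurableEmbedding_boundaryPoint hK).comap_apply _ U
  have key : ∀ k : ℝ, 1 < k → ∀ U, MeasurableSet U →
      μ U ≤ ENNReal.ofReal (k * (k ^ 2) ^ n * (k ^ 2) ^ (n - 1)) * ν U ∧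
      ν U ≤ ENNReal.ofReal (k * (k ^ 2) ^ n * (k ^ 2) ^ (n - 1)) * μ U := by
    intro k hk U hU
    obtain ⟨P, t, hPm, hcover, hP⟩ := exists_finset_cover_isNearHyperplane hK hk
    refine ⟨measure_le_mul_of_finset_cover hPm (fun p hp A hA hAm => ?_) hU
      (hcover ▸ Set.subset_univ U), measure_le_mul_of_finset_cover hPm
      (fun p hp A hA hAm => ?_) hU (hcover ▸ Set.subset_univ U)⟩
    · obtain ⟨h, l, M, hh, hl, hM, hnear⟩ := hP p hp
      rw [hμapply]
      exact euclideanHausdorffMeasure_le_of_isNearHyperplane hn hK hk hh hl hM hAm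
        fun u hu => hnear u (hA hu)
    · obtain ⟨h, l, M, hh, hl, hM, hnear⟩ := hP p hp
      rw [hμapply]
      exact withDensity_boundaryJacobian_le_of_isNearHyperplane hn hK hk hh hl hM hAm
        fun u hu => hnear u (hA hu)
  -- The two measures agree up to a factor that depends on `k` and `n` only, not on the patches, so
  -- `k ↓ 1` gives equality.
  have hlim : Tendsto (fun k : ℝ => ENNReal.ofReal (k * (k ^ 2) ^ n * (k ^ 2) ^ (n - 1))) (𝓝[>] 1)
      (𝓝 1) := by
    have hc : Continuous fun k : ℝ => ENNReal.ofReal (k * (k ^ 2) ^ n * (k ^ 2) ^ (n - 1)) :=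
      ENNReal.continuous_ofReal.comp (by fun_prop)
    have := hc.tendsto 1
    simp only [one_pow, mul_one, ENNReal.ofReal_one] at this
    exact this.mono_left nhdsWithin_le_nhds
  ext U hU
  refine le_antisymm ?_ ?_
  · have h1 := ENNReal.Tendsto.mul_const (b := ν U) hlim (Or.inl one_ne_zero)
    rw [one_mul] at h1
    refine ge_of_tendsto h1 ?_
    filter_upwards [self_mem_nhdsWithin] with k hk
    exact (key k hk U hU).1
  · have h1 := ENNReal.Tendsto.mul_const (b := μ U) hlim (Or.inl one_ne_zero)
    rw [one_mul] at h1
    refine ge_of_tendsto h1 ?_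
    filter_upwards [self_mem_nhdsWithin] with k hk
    exact (key k hk U hU).2

end SurfaceMeasure

/-! ### The Gaussian surface area measure and its uniqueness. -/

section GaussianSurfaceArea

variable {n : ℕ} {K : ConvexBody (EuclideanSpace ℝ (Fin n))}

/-- Almost everywhere the denominator is `h_K` at the normal, which is at least the inradius-type
bound `r`. -/
lemma exists_ae_boundaryJacobian_le
    (hK : (0 : EuclideanSpace ℝ (Fin n)) ∈ interior (K : Set (EuclideanSpace ℝ (Fin n)))) :
    ∃ C, ∀ᵐ u ∂(volume : Measure (EuclideanSpace ℝ (Fin n))).toSphere,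
      0 ≤ boundaryJacobian K u ∧ boundaryJacobian K u ≤ C := by
  obtain ⟨r, hr, hrK⟩ := exists_pos_le_supportFunction hK
  obtain ⟨R, hR⟩ := isCompact_univ.exists_bound_of_continuousOn
    (continuous_boundaryPoint hK).continuousOn
  refine ⟨R ^ n / r, ?_⟩
  filter_upwards [ae_differentiableAt_gauge hK] with u hu
  have hw := (isOuterUnitNormal_gaussMap hK hu).2
  have h1 := hR u (Set.mem_univ u)
  have h2 := hrK (gaussMap K u)
  rw [boundaryJacobian, hw]
  have hR0 : 0 ≤ R := (norm_nonneg _).trans h1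
  exact ⟨div_nonneg (by positivity) (hr.le.trans h2), by gcongr⟩

/-- The density with respect to the spherical measure of the Gaussian surface measure of `∂K`,
pulled back along `boundaryPoint K`. -/
noncomputable def gaussianDensity (K : ConvexBody (EuclideanSpace ℝ (Fin n)))
    (u : UnitSphere n) : ℝ :=
  1 / (√(2 * Real.pi)) ^ n * (Real.exp (-‖boundaryPoint K u‖ ^ 2 / 2) * boundaryJacobian K u)

lemma measurable_gaussianDensity
    (hK : (0 : EuclideanSpace ℝ (Fin n)) ∈ interior (K : Set (EuclideanSpace ℝ (Fin n)))) :
    Measurable (gaussianDensity K) :=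
  (((((continuous_boundaryPoint hK).measurable.norm.pow_const 2).neg.div_const 2).exp).mul
    (measurable_boundaryJacobian hK)).const_mul _

lemma gaussianDensity_nonneg_ae
    (hK : (0 : EuclideanSpace ℝ (Fin n)) ∈ interior (K : Set (EuclideanSpace ℝ (Fin n)))) :
    ∀ᵐ u ∂(volume : Measure (EuclideanSpace ℝ (Fin n))).toSphere, 0 ≤ gaussianDensity K u := by
  obtain ⟨C, hC⟩ := exists_ae_boundaryJacobian_le hK
  filter_upwards [hC] with u hu
  exact mul_nonneg (by positivity) (mul_nonneg (Real.exp_pos _).le hu.1)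

lemma integrable_gaussianDensity
    (hK : (0 : EuclideanSpace ℝ (Fin n)) ∈ interior (K : Set (EuclideanSpace ℝ (Fin n)))) :
    Integrable (gaussianDensity K) (volume : Measure (EuclideanSpace ℝ (Fin n))).toSphere := by
  obtain ⟨C, hC⟩ := exists_ae_boundaryJacobian_le hK
  refine Integrable.of_bound (measurable_gaussianDensity hK).aestronglyMeasurable
    (1 / (√(2 * Real.pi)) ^ n * C) ?_
  filter_upwards [hC, gaussianDensity_nonneg_ae hK] with u hu h0
  rw [Real.norm_of_nonneg h0, gaussianDensity]
  refine mul_le_mul_of_nonneg_left ?_ (by positivity)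
  have h1 : Real.exp (-‖boundaryPoint K u‖ ^ 2 / 2) ≤ 1 :=
    Real.exp_le_one_iff.2 (by nlinarith [sq_nonneg ‖boundaryPoint K u‖])
  exact (mul_le_of_le_one_left hu.1 h1).trans hu.2

/-- The Gaussian surface area measure of `K`. -/
noncomputable def gaussianSurfaceAreaMeasure (K : ConvexBody (EuclideanSpace ℝ (Fin n))) :
    Measure (UnitSphere n) :=
  ((volume : Measure (EuclideanSpace ℝ (Fin n))).toSphere.withDensity
    fun u => ENNReal.ofReal (gaussianDensity K u)).map (gaussMap K)

lemma isFiniteMeasure_gaussianSurfaceAreaMeasure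
    (hK : (0 : EuclideanSpace ℝ (Fin n)) ∈ interior (K : Set (EuclideanSpace ℝ (Fin n)))) :
    IsFiniteMeasure (gaussianSurfaceAreaMeasure K) := by
  have := isFiniteMeasure_withDensity_ofReal (integrable_gaussianDensity hK).2
  exact Measure.isFiniteMeasure_map _ _

lemma hasGaussianFirstVariation_gaussianSurfaceAreaMeasure (hn : 1 ≤ n)
    (hK : (0 : EuclideanSpace ℝ (Fin n)) ∈ interior (K : Set (EuclideanSpace ℝ (Fin n)))) :
    HasGaussianFirstVariation K (gaussianSurfaceAreaMeasure K) := by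
  intro f
  have heq : ∫ v, f v ∂(gaussianSurfaceAreaMeasure K) = ∫ u : UnitSphere n,
      gaussianDensity K u * f (gaussMap K u)
      ∂(volume : Measure (EuclideanSpace ℝ (Fin n))).toSphere := by
    rw [gaussianSurfaceAreaMeasure, integral_map (measurable_gaussMap K).aemeasurable
      f.continuous.aestronglyMeasurable, integral_withDensity_eq_integral_toReal_smul
      (measurable_gaussianDensity hK).ennreal_ofReal
      (Eventually.of_forall fun _ => ENNReal.ofReal_lt_top)]
    refine integral_congr_ae ?_
    filter_upwards [gaussianDensity_nonneg_ae hK] with u hu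
    rw [ENNReal.toReal_ofReal hu, smul_eq_mul]
  rw [heq]
  exact tendsto_gaussianMeasure_slope hn hK f

/-- Boundary points in directions where the gauge is not differentiable are null, because the
pulled-back surface measure is absolutely continuous. Elsewhere the normal is unique and equals
`gaussMap K`. -/
lemma inverseGaussImage_ae_eq (hn : 1 ≤ n)
    (hK : (0 : EuclideanSpace ℝ (Fin n)) ∈ interior (K : Set (EuclideanSpace ℝ (Fin n))))
    (η : Set (UnitSphere n)) :
    inverseGaussImage K η =ᵐ[μHE[n - 1]] boundaryPoint K '' (gaussMap K ⁻¹' η) := by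
  set N := {u : UnitSphere n | ¬ DifferentiableAt ℝ
    (gauge (K : Set (EuclideanSpace ℝ (Fin n)))) (u : EuclideanSpace ℝ (Fin n))} with hN
  have hnull : μHE[n - 1] (boundaryPoint K '' N) = 0 := by
    rw [← (measurableEmbedding_boundaryPoint hK).comap_apply,
      comap_boundaryPoint_euclideanHausdorffMeasure hn hK]
    exact withDensity_absolutelyContinuous _ _ (ae_iff.1 (ae_differentiableAt_gauge hK))
  filter_upwards [measure_eq_zero_iff_ae_notMem.1 hnull] with x hx
  refine propext ⟨?_, ?_⟩
  · rintro ⟨hxf, w, hwη, hw⟩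
    rw [← range_boundaryPoint hK] at hxf
    obtain ⟨u, rfl⟩ := hxf
    have hd : DifferentiableAt ℝ (gauge (K : Set (EuclideanSpace ℝ (Fin n))))
        (u : EuclideanSpace ℝ (Fin n)) := not_not.1 fun h => hx ⟨u, h, rfl⟩
    refine ⟨u, ?_, rfl⟩
    rwa [Set.mem_preimage, ← eq_gaussMap_of_isOuterUnitNormal hK hd hw]
  · rintro ⟨u, hu, rfl⟩
    have hd : DifferentiableAt ℝ (gauge (K : Set (EuclideanSpace ℝ (Fin n))))
        (u : EuclideanSpace ℝ (Fin n)) := not_not.1 fun h => hx ⟨u, h, rfl⟩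
    exact ⟨boundaryPoint_mem_frontier hK u, _, hu, isOuterUnitNormal_gaussMap hK hd⟩

lemma isGaussianSurfaceAreaMeasure_gaussianSurfaceAreaMeasure (hn : 1 ≤ n)
    (hK : (0 : EuclideanSpace ℝ (Fin n)) ∈ interior (K : Set (EuclideanSpace ℝ (Fin n)))) :
    IsGaussianSurfaceAreaMeasure K (gaussianSurfaceAreaMeasure K) := by
  intro η hη
  have hA : MeasurableSet (gaussMap K ⁻¹' η) := measurable_gaussMap K hη
  have hb := measurableEmbedding_boundaryPoint hK
  have hg : Measurable fun u : UnitSphere n =>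
      ENNReal.ofReal (Real.exp (-‖boundaryPoint K u‖ ^ 2 / 2)) :=
    (((hb.measurable.norm.pow_const 2).neg.div_const 2).exp).ennreal_ofReal
  have hJ := (measurable_boundaryJacobian hK).ennreal_ofReal
  have hsurf : ∫⁻ x in boundaryPoint K '' (gaussMap K ⁻¹' η),
      ENNReal.ofReal (Real.exp (-‖x‖ ^ 2 / 2)) ∂μHE[n - 1] =
      ∫⁻ u in gaussMap K ⁻¹' η, ENNReal.ofReal (boundaryJacobian K u) *
        ENNReal.ofReal (Real.exp (-‖boundaryPoint K u‖ ^ 2 / 2))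
        ∂(volume : Measure (EuclideanSpace ℝ (Fin n))).toSphere := by
    -- Restricting first to the range of `boundaryPoint K` exhibits the surface measure as the `map`
    -- of its `comap`, whose density is known.
    rw [← Measure.restrict_restrict_of_subset (Set.image_subset_range (boundaryPoint K) _),
      ← hb.map_comap, hb.restrict_map, hb.lintegral_map,
      Set.preimage_image_eq _ (injective_boundaryPoint hK),
      comap_boundaryPoint_euclideanHausdorffMeasure hn hK, restrict_withDensity hA,
      lintegral_withDensity_eq_lintegral_mul _ hJ hg]
    rfl
  rw [gaussianSurfaceArea, setLIntegral_congr (inverseGaussImage_ae_eq hn hK η), hsurf,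
    gaussianSurfaceAreaMeasure, Measure.map_apply (measurable_gaussMap K) hη,
    withDensity_apply _ hA, ← lintegral_const_mul' _ _ ENNReal.ofReal_ne_top]
  refine lintegral_congr fun u => ?_
  rw [gaussianDensity, ENNReal.ofReal_mul (by positivity), ENNReal.ofReal_mul (Real.exp_pos _).le,
    mul_comm (ENNReal.ofReal (Real.exp _))]

lemma eq_of_hasGaussianFirstVariation {μ ν : Measure (UnitSphere n)} [IsFiniteMeasure μ]
    [IsFiniteMeasure ν] (hμ : HasGaussianFirstVariation K μ)
    (hν : HasGaussianFirstVariation K ν) : μ = ν :=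
  ext_of_forall_integral_eq_of_IsFiniteMeasure fun f =>
    tendsto_nhds_unique (hμ f.toContinuousMap) (hν f.toContinuousMap)

end GaussianSurfaceArea

theorem theorem3p2 (n : ℕ) (hn : 1 ≤ n) (K : ConvexBody (EuclideanSpace ℝ (Fin n)))
    (hK : (0 : EuclideanSpace ℝ (Fin n)) ∈ interior (K : Set (EuclideanSpace ℝ (Fin n)))) :
    ∃ S : Measure (UnitSphere n),
      IsFiniteMeasure S ∧
      IsGaussianSurfaceAreaMeasure K S ∧
      HasGaussianFirstVariation K S ∧
      ∀ μ : Measure (UnitSphere n),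
        IsFiniteMeasure μ → HasGaussianFirstVariation K μ → μ = S := by
  have hfin := isFiniteMeasure_gaussianSurfaceAreaMeasure hK
  have hvar := hasGaussianFirstVariation_gaussianSurfaceAreaMeasure hn hK
  exact ⟨gaussianSurfaceAreaMeasure K, hfin,
    isGaussianSurfaceAreaMeasure_gaussianSurfaceAreaMeasure hn hK, hvar,
    fun μ _ hμ => eq_of_hasGaussianFirstVariation hμ hvar⟩
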